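/- \textbf{Theorem.} Over $\mathsf{WKL}_0$, $\mathsf{ACA}$ is equivalent to the statement that every system contains a minimal subsystem. That is, for every structure $\mathcal M=(M,S,0,1,+,\cdot,<)$ for the language of second-order arithmetic (with arbitrary, possibly nonstandard, first-order part $M$, and with set quantifiers ranging over $S\subseteq\mathcal P(M)$) which is a model of $\mathsf{WKL}_0$: $\mathcal M$ satisfies the arithmetical comprehension scheme $\mathsf{ACA}$ if and only if $\mathcal M$ satisfies the sentence ``every system contains a minimal subsystem''. Here $\mathsf{RCA}_0$ consists of the basic axioms of second-order arithmetic, induction for $\Sigma^0_1$ formulas and comprehension for $\Delta^0_1$ predicates (with parameters); $\mathsf{WKL}_0$ is $\mathsf{RCA}_0$ together with the statement that every infinite tree $T\subseteq 2^{<\omega}$ has a path. The following definitions are made in second-order arithmetic, i.e. interpreted inside $\mathcal M$. For a tree $C\subseteq 2^{<\omega}$, $[C]$ denotes the class of paths through $C$. A function $f:2^{<\omega}\to2^{<\omega}$ \emph{encodes a continuous transformation of $2^\omega$} if it is total, $\sigma\preceq\tau$ implies $f(\sigma)\preceq f(\tau)$, for every $l$ there is an $m$ such that $|f(\sigma)|\ge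 l$ for all $\sigma$ of length $m$, and (a normalization) $|f(\sigma)|<|\sigma|$ for every non-empty string $\sigma$. A \emph{system} is a pair $(C,f)$ where $C\subseteq2^{<\omega}$ is a tree, $f$ encodes a continuous transformation of $2^\omega$, $[C]\neq\emptyset$, and $f(\sigma)\in C$ for all $\sigma\in C$. A system $(C,f)$ is \emph{minimal} if every system $(D,f)$ with $[D]\subseteq[C]$ satisfies $[D]=[C]$. A system $(C,f)$ \emph{contains a minimal subsystem} if there is a minimal system $(D,f)$ with $[D]\subseteq[C]$. -/

import Mathlib

/-! Second-order arithmetic, and topological dynamical systems on Cantor space inside its models.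

A structure for the language of second-order arithmetic consists of a first-order part `M`
(equipped with `0`, `1`, `+`, `*`, `<`, no laws being presupposed) and a second-order part
`S : Set (Set M)`.  Number quantifiers range over `M`, which may be nonstandard, and set
quantifiers range over the members of `S`. -/

namespace SOA

universe u

section ArithmeticalFormulas

/-- Numerical terms with number parameters from `M` and free number variables
`x_0, …, x_{n-1}`. -/
inductive Term (M : Type u) (n : ℕ) : Type u
  | var (i : Fin n) : Term M n
  | param (a : M) : Term M n
  | zero : Term M n
  | one : Term M n
  | add (s t : Term M n) : Term M n
  | mul (s t : Term M n) : Term M n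

/-- Arithmetical formulas (no set quantifiers) with number parameters from `M`, set parameters
from `S`, and free number variables `x_0, …, x_{n-1}`.  A quantifier binds the variable `x_0` of
its scope and shifts the others; in `ball t φ` (meaning `∀ x < t, φ`) the new variable therefore
does not occur in `t`. -/
inductive Formula {M : Type u} (S : Set (Set M)) : ℕ → Type u
  | eq {n : ℕ} (s t : Term M n) : Formula S n
  | lt {n : ℕ} (s t : Term M n) : Formula S n
  | mem {n : ℕ} (t : Term M n) (X : S) : Formula S n
  | not {n : ℕ} (φ : Formula S n) : Formula S n
  | and {n : ℕ} (φ ψ : Formula S n) : Formula S n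
  | ball {n : ℕ} (t : Term M n) (φ : Formula S (n + 1)) : Formula S n
  | all {n : ℕ} (φ : Formula S (n + 1)) : Formula S n

/-- `φ` is a bounded-quantifier (that is, `Σ⁰₀`) formula: it has no unbounded quantifier. -/
def Formula.IsBounded {M : Type u} {S : Set (Set M)} : {n : ℕ} → Formula S n → Prop
  | _, .eq _ _ => True
  | _, .lt _ _ => True
  | _, .mem _ _ => True
  | _, .not φ => φ.IsBounded
  | _, .and φ ψ => φ.IsBounded ∧ ψ.IsBounded
  | _, .ball _ φ => φ.IsBounded
  | _, .all _ => False

end ArithmeticalFormulas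

section Semantics

variable {M : Type u} [Zero M] [One M] [Add M] [Mul M] [LT M]

/-- Value of a term under an assignment of its variables. -/
def Term.val {n : ℕ} (v : Fin n → M) : Term M n → M
  | .var i => v i
  | .param a => a
  | .zero => 0
  | .one => 1
  | .add s t => s.val v + t.val v
  | .mul s t => s.val v * t.val v

/-- Truth of an arithmetical formula under an assignment of its free variables. -/
def Formula.Holds {S : Set (Set M)} : {n : ℕ} → Formula S n → (Fin n → M) → Prop
  | _, .eq s t, v => s.val v = t.val v
  | _, .lt s t, v => s.val v < t.val v
  | _, .mem t X, v => t.val v ∈ X.1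
  | _, .not φ, v => ¬ φ.Holds v
  | _, .and φ ψ, v => φ.Holds v ∧ ψ.Holds v
  | _, .ball t φ, v => ∀ x : M, x < t.val v → φ.Holds (Fin.cons x v)
  | _, .all φ, v => ∀ x : M, φ.Holds (Fin.cons x v)

end Semantics

section Axioms

/-- The basic axioms of second-order arithmetic (about the first-order part only). -/
structure BasicAxioms (M : Type u) [Zero M] [One M] [Add M] [Mul M] [LT M] : Prop where
  succ_ne_zero : ∀ n : M, n + 1 ≠ 0
  succ_inj : ∀ m n : M, m + 1 = n + 1 → m = n
  add_zero : ∀ m : M, m + 0 = m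
  add_succ : ∀ m n : M, m + (n + 1) = (m + n) + 1
  mul_zero : ∀ m : M, m * 0 = 0
  mul_succ : ∀ m n : M, m * (n + 1) = m * n + m
  not_lt_zero : ∀ m : M, ¬ m < 0
  lt_succ : ∀ m n : M, m < n + 1 ↔ (m < n ∨ m = n)

variable {M : Type u} [Zero M] [One M] [Add M] [Mul M] [LT M]

/-- Induction for all `Σ⁰₁` formulas `φ(x) = ∃ y, θ(y, x)`, with parameters. -/
def SigmaOneInduction (S : Set (Set M)) : Prop :=
  ∀ θ : Formula S 2, θ.IsBounded →
    (∃ y : M, θ.Holds ![y, 0]) →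
    (∀ x : M, (∃ y : M, θ.Holds ![y, x]) → ∃ y : M, θ.Holds ![y, x + 1]) →
    ∀ x : M, ∃ y : M, θ.Holds ![y, x]

/-- `Δ⁰₁` comprehension, with parameters. -/
def DeltaOneComprehension (S : Set (Set M)) : Prop :=
  ∀ θ ψ : Formula S 2, θ.IsBounded → ψ.IsBounded →
    (∀ x : M, (∃ y : M, θ.Holds ![y, x]) ↔ (∀ y : M, ψ.Holds ![y, x])) →
    {x : M | ∃ y : M, θ.Holds ![y, x]} ∈ S

/-- `RCA₀`. -/
structure RCA0 (S : Set (Set M)) : Prop where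
  basic : BasicAxioms M
  induction : SigmaOneInduction S
  comprehension : DeltaOneComprehension S

/-- `ACA`: comprehension for all arithmetical formulas, with parameters. -/
def ACA (S : Set (Set M)) : Prop :=
  ∀ φ : Formula S 1, {x : M | φ.Holds ![x]} ∈ S

end Axioms

section Coding

variable {M : Type u} [Zero M] [One M] [Add M] [Mul M] [LT M]

/-- The pairing function `(i, j) ↦ (i + j)² + i`. -/
def pair (i j : M) : M := (i + j) * (i + j) + i

/-- `c` is a triple `(l, (m, n))`, regarded as a (possibly redundant) code for the binary string
of length `l` whose `i`-th entry is `1` exactly when `m (i + 1) + 1` divides `n`. -/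
def HasLength (c l : M) : Prop := ∃ m n : M, c = pair l (pair m n)

/-- The `i`-th entry of the string with code `c` exists and is `1`. -/
def HasOne (c i : M) : Prop :=
  ∃ l m n : M, c = pair l (pair m n) ∧ i < l ∧ ∃ q : M, n = (m * (i + 1) + 1) * q

/-- `c` is (the code of) a finite binary string, an element of `2^{<ω}`: it is the least one among
the codes of the same string. Hence different strings in this sense differ extensionally. -/
def IsString (c : M) : Prop :=
  (∃ l : M, HasLength c l) ∧
    ∀ d : M, d < c →
      ¬ ((∀ l : M, HasLength d l ↔ HasLength c l) ∧ ∀ i : M, HasOne d i ↔ HasOne c i)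

/-- The string `σ` is an initial segment of the string `τ`. -/
def IsPrefix (σ τ : M) : Prop :=
  ∃ k l : M, HasLength σ k ∧ HasLength τ l ∧ (k < l ∨ k = l) ∧
    ∀ i : M, i < k → (HasOne σ i ↔ HasOne τ i)

/-- The string `σ` is an initial segment of (the characteristic function of) the set `X`. -/
def IsInitSeg (σ : M) (X : Set M) : Prop :=
  ∃ k : M, HasLength σ k ∧ ∀ i : M, i < k → (HasOne σ i ↔ i ∈ X)

/-- `T` is a tree in `2^{<ω}`. -/
structure IsTree (T : Set M) : Prop where
  isString : ∀ σ ∈ T, IsString σ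
  prefix_mem : ∀ τ ∈ T, ∀ σ : M, IsString σ → IsPrefix σ τ → σ ∈ T

/-- `[T]`: the paths through `T` that belong to the model with second-order part `S`. -/
def paths (S : Set (Set M)) (T : Set M) : Set (Set M) :=
  {X | X ∈ S ∧ ∀ σ : M, IsString σ → IsInitSeg σ X → σ ∈ T}

/-- `WKL`: every infinite tree in `2^{<ω}` has a path. -/
def WKL (S : Set (Set M)) : Prop :=
  ∀ T ∈ S, IsTree T → (∀ k : M, ∃ σ ∈ T, k < σ) → (paths S T).Nonempty

/-- `WKL₀`. -/
structure WKL0 (S : Set (Set M)) : Prop where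
  rca0 : RCA0 S
  wkl : WKL S

end Coding

section Dynamics

variable {M : Type u} [Zero M] [One M] [Add M] [Mul M] [LT M]

/-- `f` encodes a continuous transformation of `2^ω`: it is (the graph of) a total, order
preserving function `2^{<ω} → 2^{<ω}` such that for every `l` there is `m` with `|f(σ)| ≥ l` for
all strings `σ` of length `m`, and such that `|f(σ)| < |σ|` for every nonempty string `σ`. -/
structure EncodesTransformation (f : Set M) : Prop where
  graph : ∀ p ∈ f, ∃ σ τ : M, IsString σ ∧ IsString τ ∧ p = pair σ τ
  total : ∀ σ : M, IsString σ → ∃! τ : M, pair σ τ ∈ f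
  order_preserving : ∀ σ σ' τ τ' : M, pair σ σ' ∈ f → pair τ τ' ∈ f →
    IsPrefix σ τ → IsPrefix σ' τ'
  length_unbounded : ∀ l : M, ∃ m : M, ∀ σ τ : M, pair σ τ ∈ f → HasLength σ m →
    ∃ k : M, HasLength τ k ∧ (l < k ∨ l = k)
  length_lt : ∀ σ τ : M, pair σ τ ∈ f → ∀ k l : M, HasLength σ k → HasLength τ l →
    k ≠ 0 → l < k

/-- `(C, f)` encodes a (topological dynamical) system in the model with second-order part `S`. -/
structure IsSystem (S : Set (Set M)) (C f : Set M) : Prop where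
  tree_mem : C ∈ S
  map_mem : f ∈ S
  tree : IsTree C
  map : EncodesTransformation f
  paths_nonempty : (paths S C).Nonempty
  map_closed : ∀ σ ∈ C, ∀ τ : M, pair σ τ ∈ f → τ ∈ C

/-- The system `(C, f)` is minimal. -/
structure IsMinimal (S : Set (Set M)) (C f : Set M) : Prop where
  system : IsSystem S C f
  minimal : ∀ D : Set M, IsSystem S D f → paths S D ⊆ paths S C → paths S D = paths S C

/-- Every system contains a minimal subsystem. -/
def EverySystemContainsMinimal (S : Set (Set M)) : Prop :=
  ∀ C f : Set M, IsSystem S C f →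
    ∃ D : Set M, IsMinimal S D f ∧ paths S D ⊆ paths S C

end Dynamics

end SOA

/-! ACA gives minimal subsystems by greedy removal of strings. Run through the numbers `k` in order
and put `k` into `A` if it can be avoided together with the members of `A` below `k`: for each
length there is a finite subset of `C`, closed under prefixes and under `f`, that avoids them and
has a string of that length (`Avoidable`). This is arithmetical in what is already decided, so
`exists_recursive_set` yields `A`. Let `D` be the union of all such finite sets avoiding `A`. Every
finite stage of `A` is avoidable and strings of given length have bounded codes, so `D` is infinite
and has a path by WKL. If a subsystem `E` of `D` misses a path `X` of `D`, some initial segment `σ`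
of `X` is outside `E`. The truncations of `D ∩ E`, closed under `f` because `f` does not lengthen
strings, show that `σ` was avoidable. Hence `σ ∈ A`, contradicting `σ ∈ D`.

Conversely, it suffices to form `{n | ∃ s, pair s n ∈ R}` for `R ∈ S` (`ACA.of_exists`). View points
of Cantor space as sequences of rows, with the shift of all rows as transformation. In `rowTree R`,
row `n` must contain ones with bounded gaps if `n` has a witness `s`, and at most one 1 otherwise.
In a minimal subsystem, a witnessed `n` gives a path with a 1 at the start of row `n`, by shifting.
For an unwitnessed `n` such a path is impossible: one further shift empties the row, so the paths
with row `n` empty would form a proper subsystem (`IsMinimal.exists_iff`). By WKL, existence of a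
path through a given 1 is a `Π⁰₁` condition on the tree, so the set is `Δ⁰₁`.

The rest develops coding in a possibly nonstandard model: the classes `Dec` and `Fn` track
membership in `S` of predicates and functions, and Gödel's β function supplies finite strings. -/

namespace SOA

set_option linter.unusedSectionVars false
set_option synthInstance.maxSize 1000

/-! ### Ordered semiring structure of the first-order part -/

section Arithmetic

variable {M : Type*} [Zero M] [One M] [Add M] [Mul M] [LT M] {S : Set (Set M)}

/-- `Σ⁰₁` induction for a property presented by a bounded formula. -/
theorem RCA0.induct_exists (h : RCA0 S) (θ : Formula S 2) (hθ : θ.IsBounded) {R : M → M → Prop}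
    (hR : ∀ y x, θ.Holds ![y, x] ↔ R y x) (zero : ∃ y, R y 0)
    (succ : ∀ x, (∃ y, R y x) → ∃ y, R y (x + 1)) (x : M) : ∃ y, R y x := by
  simpa only [hR] using h.induction θ hθ (by simpa only [hR] using zero)
    (by simpa only [hR] using succ) x

/-- Induction for a property presented by a bounded formula. -/
theorem RCA0.induct (h : RCA0 S) (θ : Formula S 2) (hθ : θ.IsBounded) {P : M → Prop}
    (hP : ∀ y x, θ.Holds ![y, x] ↔ P x) (zero : P 0) (succ : ∀ x, P x → P (x + 1)) (x : M) :
    P x := by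
  obtain ⟨-, hx⟩ := h.induct_exists θ hθ (R := fun _ x => P x) hP ⟨0, zero⟩
    (fun x ⟨y, hy⟩ => ⟨y, succ x hy⟩) x
  exact hx

namespace RCA0

theorem zero_add (h : RCA0 S) (x : M) : 0 + x = x :=
  h.induct (.eq (.add .zero (.var 1)) (.var 1)) trivial (P := fun x => 0 + x = x)
    (fun _ _ => Iff.rfl) (h.basic.add_zero 0) (fun x hx => by rw [h.basic.add_succ, hx]) x

theorem succ_add (h : RCA0 S) (a x : M) : a + 1 + x = a + x + 1 :=
  h.induct (.eq (.add (.add (.param a) .one) (.var 1)) (.add (.add (.param a) (.var 1)) .one))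
    trivial (P := fun x => a + 1 + x = a + x + 1) (fun _ _ => Iff.rfl)
    (by rw [h.basic.add_zero, h.basic.add_zero])
    (fun x hx => by rw [h.basic.add_succ, hx, h.basic.add_succ]) x

theorem add_comm (h : RCA0 S) (a x : M) : a + x = x + a :=
  h.induct (.eq (.add (.param a) (.var 1)) (.add (.var 1) (.param a)))
    trivial (P := fun x => a + x = x + a) (fun _ _ => Iff.rfl)
    (by rw [h.basic.add_zero, h.zero_add])
    (fun x hx => by rw [h.basic.add_succ, hx, h.succ_add]) x

theorem add_assoc (h : RCA0 S) (a b x : M) : a + b + x = a + (b + x) :=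
  h.induct (.eq (.add (.add (.param a) (.param b)) (.var 1))
      (.add (.param a) (.add (.param b) (.var 1))))
    trivial (P := fun x => a + b + x = a + (b + x)) (fun _ _ => Iff.rfl)
    (by rw [h.basic.add_zero, h.basic.add_zero])
    (fun x hx => by rw [h.basic.add_succ, hx, h.basic.add_succ, h.basic.add_succ]) x

theorem zero_mul (h : RCA0 S) (x : M) : 0 * x = 0 :=
  h.induct (.eq (.mul .zero (.var 1)) .zero) trivial (P := fun x => 0 * x = 0)
    (fun _ _ => Iff.rfl) (h.basic.mul_zero 0)
    (fun x hx => by rw [h.basic.mul_succ, hx, h.basic.add_zero]) x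

theorem mul_one (h : RCA0 S) (a : M) : a * 1 = a := by
  have := h.basic.mul_succ a 0
  rwa [h.zero_add, h.basic.mul_zero, h.zero_add] at this

theorem succ_mul (h : RCA0 S) (a x : M) : (a + 1) * x = a * x + x :=
  h.induct (.eq (.mul (.add (.param a) .one) (.var 1)) (.add (.mul (.param a) (.var 1)) (.var 1)))
    trivial (P := fun x => (a + 1) * x = a * x + x) (fun _ _ => Iff.rfl)
    (by rw [h.basic.mul_zero, h.basic.mul_zero, h.zero_add])
    (fun x hx => by
      rw [h.basic.mul_succ, hx, h.basic.mul_succ, h.add_assoc, h.add_assoc, h.basic.add_succ x a,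
        h.basic.add_succ a x, h.add_comm x a]) x

theorem mul_comm (h : RCA0 S) (a x : M) : a * x = x * a :=
  h.induct (.eq (.mul (.param a) (.var 1)) (.mul (.var 1) (.param a)))
    trivial (P := fun x => a * x = x * a) (fun _ _ => Iff.rfl)
    (by rw [h.basic.mul_zero, h.zero_mul])
    (fun x hx => by rw [h.basic.mul_succ, hx, h.succ_mul]) x

theorem mul_add (h : RCA0 S) (a b x : M) : a * (b + x) = a * b + a * x :=
  h.induct (.eq (.mul (.param a) (.add (.param b) (.var 1)))
      (.add (.mul (.param a) (.param b)) (.mul (.param a) (.var 1))))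
    trivial (P := fun x => a * (b + x) = a * b + a * x) (fun _ _ => Iff.rfl)
    (by rw [h.basic.mul_zero, h.basic.add_zero, h.basic.add_zero])
    (fun x hx => by rw [h.basic.add_succ, h.basic.mul_succ, hx, h.basic.mul_succ, h.add_assoc]) x

theorem mul_assoc (h : RCA0 S) (a b x : M) : a * b * x = a * (b * x) :=
  h.induct (.eq (.mul (.mul (.param a) (.param b)) (.var 1))
      (.mul (.param a) (.mul (.param b) (.var 1))))
    trivial (P := fun x => a * b * x = a * (b * x)) (fun _ _ => Iff.rfl)
    (by rw [h.basic.mul_zero, h.basic.mul_zero, h.basic.mul_zero])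
    (fun x hx => by rw [h.basic.mul_succ, hx, h.basic.mul_succ, h.mul_add]) x

/-- The semiring structure of the first-order part of a model of `RCA₀`. -/
abbrev commSemiring (h : RCA0 S) : CommSemiring M where
  add_assoc := h.add_assoc
  zero_add := h.zero_add
  add_zero := h.basic.add_zero
  add_comm := h.add_comm
  mul_assoc := h.mul_assoc
  mul_comm := h.mul_comm
  one_mul a := by rw [h.mul_comm, h.mul_one]
  mul_one := h.mul_one
  zero_mul := h.zero_mul
  mul_zero := h.basic.mul_zero
  left_distrib := h.mul_add
  right_distrib a b c := by rw [h.mul_comm, h.mul_add, h.mul_comm c, h.mul_comm c]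
  nsmul := nsmulRec

theorem add_right_cancel (h : RCA0 S) {a b : M} (x : M) : a + x = b + x → a = b :=
  h.induct (.not (.and (.eq (.add (.param a) (.var 1)) (.add (.param b) (.var 1)))
      (.not (.eq (.param a) (.param b)))))
    ⟨trivial, trivial⟩ (P := fun x => a + x = b + x → a = b)
    (fun _ _ => not_and_not_right)
    (by rw [h.basic.add_zero, h.basic.add_zero]; exact id)
    (fun x hx e => hx (h.basic.succ_inj _ _ (by rwa [h.basic.add_succ, h.basic.add_succ] at e))) x

theorem lt_add_succ (h : RCA0 S) (a x : M) : a < a + (x + 1) :=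
  h.induct (.lt (.param a) (.add (.param a) (.add (.var 1) .one)))
    trivial (P := fun x => a < a + (x + 1)) (fun _ _ => Iff.rfl)
    (by rw [h.zero_add, h.basic.lt_succ]; exact .inr rfl)
    (fun x hx => by rw [h.basic.add_succ, h.basic.lt_succ]; exact .inl hx) x

theorem exists_add_of_lt (h : RCA0 S) (a x : M) (hx : a < x) : ∃ y, x = a + (y + 1) := by
  obtain ⟨y, hy⟩ := h.induct_exists (.not (.and (.lt (.param a) (.var 1))
      (.not (.eq (.var 1) (.add (.param a) (.add (.var 0) .one))))))
    ⟨trivial, trivial⟩ (R := fun y x => a < x → x = a + (y + 1))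
    (fun _ _ => not_and_not_right) ⟨0, fun h0 => (h.basic.not_lt_zero _ h0).elim⟩
    (fun x ⟨y, hy⟩ => by
      by_cases hx : a < x
      · exact ⟨y + 1, fun _ => by rw [h.basic.add_succ, ← hy hx]⟩
      · refine ⟨0, fun hx' => ?_⟩
        rw [((h.basic.lt_succ _ _).1 hx').resolve_left hx, h.zero_add]) x
  exact ⟨y, hy hx⟩

theorem eq_zero_or_eq_succ (h : RCA0 S) (x : M) : ∃ y, x = 0 ∨ x = y + 1 :=
  h.induct_exists (.not (.and (.not (.eq (.var 1) .zero)) (.not (.eq (.var 1) (.add (.var 0) .one)))))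
    ⟨trivial, trivial⟩ (R := fun y x => x = 0 ∨ x = y + 1)
    (fun y x => by
      change ¬ (¬ x = 0 ∧ ¬ x = y + 1) ↔ _
      tauto) ⟨0, .inl rfl⟩ (fun x _ => ⟨x, .inr rfl⟩) x

theorem total (h : RCA0 S) (a x : M) : ∃ y, a = x + y ∨ x = a + y :=
  h.induct_exists (.not (.and (.not (.eq (.param a) (.add (.var 1) (.var 0))))
      (.not (.eq (.var 1) (.add (.param a) (.var 0))))))
    ⟨trivial, trivial⟩ (R := fun y x => a = x + y ∨ x = a + y)
    (fun y x => by
      change ¬ (¬ a = x + y ∧ ¬ x = a + y) ↔ _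
      tauto) ⟨a, .inl (h.zero_add a).symm⟩
    (fun x ⟨y, hy⟩ => by
      rcases hy with hy | hy
      · obtain ⟨z, rfl | rfl⟩ := h.eq_zero_or_eq_succ y
        · exact ⟨1, .inr (by rw [hy, h.basic.add_zero])⟩
        · exact ⟨z, .inl (by rw [hy, h.add_comm z, h.add_assoc])⟩
      · exact ⟨y + 1, .inr (by rw [hy, h.add_assoc])⟩) x

theorem le_iff (h : RCA0 S) (a b : M) : (a < b ∨ a = b) ↔ ∃ c, b = a + c := by
  constructor
  · rintro (hab | rfl)
    · obtain ⟨y, hy⟩ := h.exists_add_of_lt a b hab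
      exact ⟨_, hy⟩
    · exact ⟨0, (h.basic.add_zero _).symm⟩
  · rintro ⟨c, rfl⟩
    obtain ⟨y, rfl | rfl⟩ := h.eq_zero_or_eq_succ c
    · exact .inr (h.basic.add_zero _).symm
    · exact .inl (h.lt_add_succ a y)

theorem lt_irrefl (h : RCA0 S) (a : M) : ¬ a < a := fun ha => by
  obtain ⟨y, hy⟩ := h.exists_add_of_lt a a ha
  refine h.basic.succ_ne_zero y (h.add_right_cancel a ?_)
  rw [h.zero_add, h.add_comm, ← hy]

theorem lt_trans (h : RCA0 S) {a b c : M} (hab : a < b) (hbc : b < c) : a < c := by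
  obtain ⟨x, rfl⟩ := h.exists_add_of_lt _ _ hab
  obtain ⟨y, rfl⟩ := h.exists_add_of_lt _ _ hbc
  rw [h.add_assoc, h.basic.add_succ]
  exact h.lt_add_succ _ _

/-- The linear order of the first-order part of a model of `RCA₀`. -/
noncomputable abbrev linearOrder (h : RCA0 S) : LinearOrder M where
  le a b := a < b ∨ a = b
  lt a b := a < b
  le_refl _ := .inr rfl
  le_trans a b c := by
    rintro (hab | rfl) (hbc | rfl)
    · exact .inl (h.lt_trans hab hbc)
    · exact .inl hab
    · exact .inl hbc
    · exact .inr rfl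
  lt_iff_le_not_ge a b := by
    constructor
    · rintro hab
      refine ⟨.inl hab, ?_⟩
      rintro (hba | rfl)
      · exact h.lt_irrefl _ (h.lt_trans hab hba)
      · exact h.lt_irrefl _ hab
    · rintro ⟨hab | rfl, hn⟩
      · exact hab
      · exact (hn (.inr rfl)).elim
  le_antisymm a b := by
    rintro (hab | rfl) (hba | hba)
    · exact (h.lt_irrefl _ (h.lt_trans hab hba)).elim
    · exact hba.symm
    · rfl
    · rfl
  le_total a b := by
    obtain ⟨y, hy | hy⟩ := h.total a b
    · exact .inr ((h.le_iff b a).2 ⟨y, hy⟩)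
    · exact .inl ((h.le_iff a b).2 ⟨y, hy⟩)
  toDecidableLE := Classical.decRel _
  toDecidableEq := Classical.decEq _
  toDecidableLT := Classical.decRel _

theorem canonicallyOrderedAdd (h : RCA0 S) :
    letI := h.linearOrder
    CanonicallyOrderedAdd M :=
  letI := h.linearOrder
  { exists_add_of_le := fun {a b} hab => (h.le_iff a b).1 hab
    le_add_self := fun a b => (h.le_iff a _).2 ⟨b, h.add_comm b a⟩
    le_self_add := fun a b => (h.le_iff a _).2 ⟨b, rfl⟩ }

theorem isStrictOrderedRing (h : RCA0 S) :
    letI := h.commSemiring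
    letI := h.linearOrder
    IsStrictOrderedRing M :=
  letI := h.commSemiring
  letI := h.linearOrder
  have mul_lt : ∀ c : M, 0 < c → ∀ a b : M, a < b → c * a < c * b := fun c hc a b hab => by
    obtain ⟨x, rfl⟩ := h.exists_add_of_lt _ _ hc
    obtain ⟨y, rfl⟩ := h.exists_add_of_lt _ _ hab
    have : (0 + (x + 1)) * (a + (y + 1)) =
        (0 + (x + 1)) * a + (x * y + x + y + 1) := by ring
    rw [this]
    exact h.lt_add_succ _ _
  { add_le_add_left := fun a b hab c => by
      obtain ⟨d, rfl⟩ := (h.le_iff a b).1 hab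
      exact (h.le_iff _ _).2 ⟨d, by rw [h.add_assoc, h.add_comm d c, h.add_assoc]⟩
    le_of_add_le_add_left := fun a b c hbc => by
      obtain ⟨d, hd⟩ := (h.le_iff _ _).1 hbc
      refine (h.le_iff b c).2 ⟨d, h.add_right_cancel a ?_⟩
      rw [h.add_comm, hd, h.add_comm _ a, h.add_assoc]
    zero_le_one := (h.le_iff _ _).2 ⟨1, (h.zero_add 1).symm⟩
    exists_pair_ne := ⟨1, 0, fun e => h.basic.succ_ne_zero 0 (by rw [h.zero_add, e])⟩
    mul_lt_mul_of_pos_left := fun c hc a b hab => mul_lt c hc a b hab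
    mul_lt_mul_of_pos_right := fun c hc a b hab => by
      rw [h.mul_comm a, h.mul_comm b]
      exact mul_lt c hc a b hab }

end RCA0

end Arithmetic

/-! ### The pairing function and its projections -/

section Pairing

variable {M : Type*} [CommSemiring M] [LinearOrder M] [IsStrictOrderedRing M]
  [CanonicallyOrderedAdd M]

theorem le_pair_left (i j : M) : i ≤ pair i j := le_add_self

theorem add_one_le_iff [Fact (BasicAxioms M)] {a b : M} : a + 1 ≤ b ↔ a < b := by
  refine ⟨fun h => lt_of_lt_of_le (lt_add_of_pos_right a zero_lt_one) h, fun h => ?_⟩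
  by_contra hb
  rcases ((Fact.out : BasicAxioms M).lt_succ b a).1 (not_le.1 hb) with h' | rfl
  · exact lt_asymm h h'
  · exact lt_irrefl _ h

theorem lt_add_one_iff [Fact (BasicAxioms M)] {a b : M} : a < b + 1 ↔ a ≤ b := by
  rw [← not_le, add_one_le_iff, not_lt]

theorem eq_zero_or_exists_add_one [Fact (BasicAxioms M)] (a : M) : a = 0 ∨ ∃ b, a = b + 1 := by
  rcases eq_or_ne a 0 with h | h
  · exact .inl h
  · have h1 : 1 ≤ a := by
      rw [← zero_add (1 : M), add_one_le_iff]
      exact pos_iff_ne_zero.2 h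
    obtain ⟨b, rfl⟩ := exists_add_of_le h1
    exact .inr ⟨b, add_comm _ _⟩

theorem le_mul_self' [Fact (BasicAxioms M)] (a : M) : a ≤ a * a := by
  rcases eq_zero_or_exists_add_one a with rfl | ⟨b, rfl⟩
  · exact zero_le
  · rw [mul_add, mul_one]
    exact le_add_self

theorem le_pair_right [Fact (BasicAxioms M)] (i j : M) : j ≤ pair i j :=
  calc j ≤ i + j := le_add_self
    _ ≤ (i + j) * (i + j) := le_mul_self' _
    _ ≤ pair i j := le_self_add

@[gcongr]
theorem pair_le_pair {i i' j j' : M} (hi : i ≤ i') (hj : j ≤ j') : pair i j ≤ pair i' j' :=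
  add_le_add (mul_le_mul' (add_le_add hi hj) (add_le_add hi hj)) hi

/-- The values of `pair` with component sum `t` lie in `[t², (t + 1)²)`, and these intervals are
disjoint for different `t`. -/
theorem add_le_of_pair_eq [Fact (BasicAxioms M)] {i i' j j' : M} (h : pair i j = pair i' j') :
    i + j ≤ i' + j' := by
  by_contra hlt
  rw [not_le, ← add_one_le_iff] at hlt
  refine absurd h (ne_of_gt ?_)
  calc pair i' j' < pair i' j' + (i' + j' + j' + 1) :=
        lt_add_of_pos_right _ (add_pos_of_nonneg_of_pos zero_le zero_lt_one)
    _ = (i' + j' + 1) * (i' + j' + 1) := by unfold pair; ring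
    _ ≤ (i + j) * (i + j) := mul_le_mul' hlt hlt
    _ ≤ pair i j := le_self_add

@[simp]
theorem pair_inj [Fact (BasicAxioms M)] {i i' j j' : M} :
    pair i j = pair i' j' ↔ i = i' ∧ j = j' := by
  refine ⟨fun h => ?_, fun ⟨h, h'⟩ => by rw [h, h']⟩
  have e : i + j = i' + j' := le_antisymm (add_le_of_pair_eq h) (add_le_of_pair_eq h.symm)
  unfold pair at h
  rw [e] at h
  have hi := add_left_cancel h
  subst hi
  exact ⟨rfl, add_left_cancel e⟩

open Classical in
/-- The first component of a pair, `0` at numbers that do not code a pair. -/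
noncomputable def fst (p : M) : M := if h : ∃ i j, p = pair i j then h.choose else 0

open Classical in
/-- The second component of a pair, `0` at numbers that do not code a pair. -/
noncomputable def snd (p : M) : M := if h : ∃ j i, p = pair i j then h.choose else 0

variable [Fact (BasicAxioms M)]

@[simp]
theorem fst_pair (i j : M) : fst (pair i j) = i := by
  have h : ∃ i' j', pair i j = pair i' j' := ⟨i, j, rfl⟩
  obtain ⟨j', hj⟩ := h.choose_spec
  rw [fst, dif_pos h]
  exact (pair_inj.1 hj).1.symm

@[simp]
theorem snd_pair (i j : M) : snd (pair i j) = j := by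
  have h : ∃ j' i', pair i j = pair i' j' := ⟨j, i, rfl⟩
  obtain ⟨i', hi⟩ := h.choose_spec
  rw [snd, dif_pos h]
  exact (pair_inj.1 hi).2.symm

/-- Both components are at most the pair, so the graph of the projection, default value included, is
given by a bounded formula. -/
theorem eq_fst_iff (x y : M) : y = fst x ↔
    (∃ j < x + 1, x = pair y j) ∨ y = 0 ∧ ∀ i < x + 1, ∀ j < x + 1, x ≠ pair i j := by
  simp only [lt_add_one_iff]
  constructor
  · rintro rfl
    by_cases h : ∃ i j, x = pair i j
    · obtain ⟨i, j, rfl⟩ := h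
      exact .inl ⟨j, le_pair_right i j, by rw [fst_pair]⟩
    · exact .inr ⟨dif_neg h, fun i _ j _ e => h ⟨i, j, e⟩⟩
  · rintro (⟨j, -, rfl⟩ | ⟨rfl, h⟩)
    · rw [fst_pair]
    · refine Eq.symm (dif_neg (c := ∃ i j, x = pair i j) ?_)
      rintro ⟨i, j, rfl⟩
      exact h i (le_pair_left i j) j (le_pair_right i j) rfl

theorem eq_snd_iff (x y : M) : y = snd x ↔
    (∃ i < x + 1, x = pair i y) ∨ y = 0 ∧ ∀ i < x + 1, ∀ j < x + 1, x ≠ pair i j := by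
  simp only [lt_add_one_iff]
  constructor
  · rintro rfl
    by_cases h : ∃ i j, x = pair i j
    · obtain ⟨i, j, rfl⟩ := h
      exact .inl ⟨i, le_pair_left i j, by rw [snd_pair]⟩
    · exact .inr ⟨dif_neg fun ⟨j, i, e⟩ => h ⟨i, j, e⟩, fun i _ j _ e => h ⟨i, j, e⟩⟩
  · rintro (⟨j, -, rfl⟩ | ⟨rfl, h⟩)
    · rw [snd_pair]
    · refine Eq.symm (dif_neg (c := ∃ j i, x = pair i j) ?_)
      rintro ⟨j, i, rfl⟩
      exact h i (le_pair_left i j) j (le_pair_right i j) rfl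

end Pairing

/-! ### Derived connectives and evaluation of formulas -/

section Formulas

variable {M : Type*} {S : Set (Set M)} {n : ℕ}

/-- Disjunction. -/
def Formula.or (φ ψ : Formula S n) : Formula S n := .not (.and (.not φ) (.not ψ))

/-- Implication. -/
def Formula.imp (φ ψ : Formula S n) : Formula S n := .not (.and φ (.not ψ))

/-- Bounded existential quantification. -/
def Formula.bex (t : Term M n) (φ : Formula S (n + 1)) : Formula S n := .not (.ball t (.not φ))

/-- The term for the pairing function. -/
def Term.pair (s t : Term M n) : Term M n := .add (.mul (.add s t) (.add s t)) s

@[simp] theorem Formula.isBounded_eq (s t : Term M n) :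
    (Formula.eq s t : Formula S n).IsBounded := trivial
@[simp] theorem Formula.isBounded_lt (s t : Term M n) :
    (Formula.lt s t : Formula S n).IsBounded := trivial
@[simp] theorem Formula.isBounded_mem (t : Term M n) (X : S) :
    (Formula.mem t X : Formula S n).IsBounded := trivial
@[simp] theorem Formula.isBounded_not (φ : Formula S n) : φ.not.IsBounded ↔ φ.IsBounded := Iff.rfl
@[simp] theorem Formula.isBounded_and (φ ψ : Formula S n) :
    (φ.and ψ).IsBounded ↔ φ.IsBounded ∧ ψ.IsBounded := Iff.rfl
@[simp] theorem Formula.isBounded_ball (t : Term M n) (φ : Formula S (n + 1)) :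
    (φ.ball t).IsBounded ↔ φ.IsBounded := Iff.rfl
@[simp] theorem Formula.isBounded_or (φ ψ : Formula S n) :
    (φ.or ψ).IsBounded ↔ φ.IsBounded ∧ ψ.IsBounded := Iff.rfl
@[simp] theorem Formula.isBounded_imp (φ ψ : Formula S n) :
    (φ.imp ψ).IsBounded ↔ φ.IsBounded ∧ ψ.IsBounded := Iff.rfl
@[simp] theorem Formula.isBounded_bex (t : Term M n) (φ : Formula S (n + 1)) :
    (φ.bex t).IsBounded ↔ φ.IsBounded := Iff.rfl

variable [Zero M] [One M] [Add M] [Mul M] [LT M] (v : Fin n → M)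

@[simp] theorem Term.val_var (i : Fin n) : (Term.var i : Term M n).val v = v i := rfl
@[simp] theorem Term.val_param (a : M) : (Term.param a : Term M n).val v = a := rfl
@[simp] theorem Term.val_zero : (Term.zero : Term M n).val v = 0 := rfl
@[simp] theorem Term.val_one : (Term.one : Term M n).val v = 1 := rfl
@[simp] theorem Term.val_add (s t : Term M n) : (s.add t).val v = s.val v + t.val v := rfl
@[simp] theorem Term.val_mul (s t : Term M n) : (s.mul t).val v = s.val v * t.val v := rfl
@[simp] theorem Term.val_pair (s t : Term M n) :
    (s.pair t).val v = SOA.pair (s.val v) (t.val v) := rfl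

@[simp] theorem Formula.holds_eq (s t : Term M n) :
    (Formula.eq s t : Formula S n).Holds v ↔ s.val v = t.val v := Iff.rfl
@[simp] theorem Formula.holds_lt (s t : Term M n) :
    (Formula.lt s t : Formula S n).Holds v ↔ s.val v < t.val v := Iff.rfl
@[simp] theorem Formula.holds_mem (t : Term M n) (X : S) :
    (Formula.mem t X : Formula S n).Holds v ↔ t.val v ∈ X.1 := Iff.rfl
@[simp] theorem Formula.holds_not (φ : Formula S n) : φ.not.Holds v ↔ ¬ φ.Holds v := Iff.rfl
@[simp] theorem Formula.holds_and (φ ψ : Formula S n) :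
    (φ.and ψ).Holds v ↔ φ.Holds v ∧ ψ.Holds v := Iff.rfl
@[simp] theorem Formula.holds_or (φ ψ : Formula S n) :
    (φ.or ψ).Holds v ↔ φ.Holds v ∨ ψ.Holds v := by
  simp only [Formula.or, holds_not, holds_and]; tauto
@[simp] theorem Formula.holds_imp (φ ψ : Formula S n) :
    (φ.imp ψ).Holds v ↔ (φ.Holds v → ψ.Holds v) := by
  simp only [Formula.imp, holds_not, holds_and]; tauto
@[simp] theorem Formula.holds_ball (t : Term M n) (φ : Formula S (n + 1)) :
    (φ.ball t).Holds v ↔ ∀ x, x < t.val v → φ.Holds (Matrix.vecCons x v) := Iff.rfl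
@[simp] theorem Formula.holds_bex (t : Term M n) (φ : Formula S (n + 1)) :
    (φ.bex t).Holds v ↔ ∃ x, x < t.val v ∧ φ.Holds (Matrix.vecCons x v) := by
  simp only [Formula.bex, holds_not, holds_ball]; push Not; rfl
@[simp] theorem Formula.holds_all (φ : Formula S (n + 1)) :
    φ.all.Holds v ↔ ∀ x, φ.Holds (Matrix.vecCons x v) := Iff.rfl

end Formulas

/-! ### Closure properties of the sets and functions of the model; induction principles -/

section Calculus

variable {M : Type*} [CommSemiring M] [LinearOrder M]

/-- The set defined by the predicate `P` belongs to `S`. -/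
class Dec (S : Set (Set M)) (P : M → Prop) : Prop where
  mem : {x | P x} ∈ S

/-- The function `F` belongs to `S`, in the sense that its graph does. -/
class Fn (S : Set (Set M)) (F : M → M) : Prop where
  graph : ∃ A ∈ S, ∀ y x, pair y x ∈ A ↔ y = F x

variable [IsStrictOrderedRing M] [CanonicallyOrderedAdd M]
variable {S : Set (Set M)} [hS : Fact (RCA0 S)]

variable [Fact (BasicAxioms M)]

theorem Dec.congr {P Q : M → Prop} (h : Dec S P) (e : ∀ x, P x ↔ Q x) : Dec S Q := by
  obtain rfl : P = Q := funext fun x => propext (e x)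
  exact h

theorem Dec.of_formulas {R Q : M → M → Prop} (θ ψ : Formula S 2) (hθ : θ.IsBounded)
    (hψ : ψ.IsBounded) (hR : ∀ y x, θ.Holds ![y, x] ↔ R y x) (hQ : ∀ y x, ψ.Holds ![y, x] ↔ Q y x)
    (h : ∀ x, (∃ y, R y x) ↔ ∀ y, Q y x) : Dec S fun x => ∃ y, R y x := by
  have := hS.out.comprehension θ ψ hθ hψ (by simpa only [hR, hQ] using h)
  simp only [hR] at this
  exact ⟨this⟩

theorem Dec.of_formula {P : M → Prop} (θ : Formula S 2) (hθ : θ.IsBounded)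
    (hP : ∀ y x, θ.Holds ![y, x] ↔ P x) : Dec S P :=
  (Dec.of_formulas θ θ hθ hθ hP hP (fun _ => by simp)).congr (fun _ => by simp)

theorem Fn.of_formula {F : M → M} (θ : Formula S 4) (hθ : θ.IsBounded)
    (hF : ∀ x y d w, θ.Holds ![x, y, d, w] ↔ y = F x) : Fn S F := by
  refine ⟨_, (Dec.of_formula (P := fun w => ∃ y < w + 1, ∃ x < w + 1, w = pair y x ∧ y = F x)
    (.bex (.add (.var 1) .one) (.bex (.add (.var 2) .one)
      (.and (.eq (.var 3) (.pair (.var 1) (.var 0))) θ))) ?_ ?_).mem, fun y x => ?_⟩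
  · simpa using hθ
  · intro y x
    simp [hF]
  · simp only [lt_add_one_iff, Set.mem_ofPred_eq]
    constructor
    · rintro ⟨y', -, x', -, e, rfl⟩
      obtain ⟨rfl, rfl⟩ := pair_inj.1 e
      rfl
    · rintro rfl
      exact ⟨_, le_pair_left _ _, _, le_pair_right _ _, rfl, rfl⟩

instance Fn.id : Fn S fun x => x := .of_formula (.eq (.var 1) (.var 0)) trivial (by simp)

instance Fn.const (a : M) : Fn S fun _ => a := .of_formula (.eq (.var 1) (.param a)) trivial (by simp)

instance Fn.fst₀ : Fn S fst :=
  .of_formula (.or (.bex (.add (.var 0) .one) (.eq (.var 1) (.pair (.var 2) (.var 0))))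
    (.and (.eq (.var 1) .zero) (.ball (.add (.var 0) .one) (.ball (.add (.var 1) .one)
      (.not (.eq (.var 2) (.pair (.var 1) (.var 0)))))))) (by simp) (fun x y d w => by
      rw [eq_fst_iff]; simp)

instance Fn.snd₀ : Fn S snd :=
  .of_formula (.or (.bex (.add (.var 0) .one) (.eq (.var 1) (.pair (.var 0) (.var 2))))
    (.and (.eq (.var 1) .zero) (.ball (.add (.var 0) .one) (.ball (.add (.var 1) .one)
      (.not (.eq (.var 2) (.pair (.var 1) (.var 0)))))))) (by simp) (fun x y d w => by
      rw [eq_snd_iff]; simp)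

/-- Substitution of functions into a ternary relation defined by a bounded formula. -/
theorem Dec.comp₃ {T : M → M → M → Prop} (κ : Formula S 5) (hκ : κ.IsBounded)
    (hT : ∀ c b a y x, κ.Holds ![c, b, a, y, x] ↔ T a b c) (F G H : M → M)
    [hF : Fn S F] [hG : Fn S G] [hH : Fn S H] : Dec S fun x => T (F x) (G x) (H x) := by
  obtain ⟨A, hA, eA⟩ := hF.graph
  obtain ⟨B, hB, eB⟩ := hG.graph
  obtain ⟨C, hC, eC⟩ := hH.graph
  -- The values of `F`, `G`, `H` have no bound by a term. A further variable `y` bounding them is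
  -- quantified existentially in one form and universally in the other, which makes the predicate
  -- `Δ⁰₁`.
  have mono : ∀ x, ∃ y, F x < y + 1 ∧ G x < y + 1 ∧ H x < y + 1 := fun x =>
    ⟨F x + G x + H x, lt_add_one_iff.2 (le_self_add.trans le_self_add),
      lt_add_one_iff.2 (le_add_self.trans le_self_add), lt_add_one_iff.2 le_add_self⟩
  let δ : Formula S 5 := .and (.mem (.pair (.var 2) (.var 4)) ⟨A, hA⟩)
      (.and (.mem (.pair (.var 1) (.var 4)) ⟨B, hB⟩) (.mem (.pair (.var 0) (.var 4)) ⟨C, hC⟩))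
  have hδ : ∀ c b a y x, δ.Holds ![c, b, a, y, x] ↔ a = F x ∧ b = G x ∧ c = H x := by
    simp [δ, eA, eB, eC]
  have main := Dec.of_formulas
    (R := fun y x => (F x < y + 1 ∧ G x < y + 1 ∧ H x < y + 1) ∧ T (F x) (G x) (H x))
    (Q := fun y x => F x < y + 1 → G x < y + 1 → H x < y + 1 → T (F x) (G x) (H x))
    (.bex (.add (.var 0) .one) (.bex (.add (.var 1) .one) (.bex (.add (.var 2) .one) (.and δ κ))))
    (.ball (.add (.var 0) .one) (.ball (.add (.var 1) .one) (.ball (.add (.var 2) .one)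
      (.imp δ κ))))
    (by simpa [δ] using hκ) (by simpa [δ] using hκ) (fun y x => ?_) (fun y x => ?_) fun x => ?_
  · refine main.congr fun x => ⟨fun ⟨y, _, h⟩ => h, fun h => ?_⟩
    obtain ⟨y, hy⟩ := mono x
    exact ⟨y, hy, h⟩
  · simp only [Formula.holds_bex, Formula.holds_and, hδ, hT]
    constructor
    · rintro ⟨_, h1, _, h2, _, h3, ⟨rfl, rfl, rfl⟩, h⟩
      exact ⟨⟨h1, h2, h3⟩, h⟩
    · rintro ⟨⟨h1, h2, h3⟩, h⟩
      exact ⟨_, h1, _, h2, _, h3, ⟨rfl, rfl, rfl⟩, h⟩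
  · simp only [Formula.holds_ball, Formula.holds_imp, hδ, hT]
    constructor
    · exact fun h h1 h2 h3 => h _ h1 _ h2 _ h3 ⟨rfl, rfl, rfl⟩
    · rintro h _ h1 _ h2 _ h3 ⟨rfl, rfl, rfl⟩
      exact h h1 h2 h3
  · constructor
    · exact fun ⟨y, _, h⟩ _ _ _ _ => h
    · intro h
      obtain ⟨y, hy⟩ := mono x
      exact ⟨y, hy, h y hy.1 hy.2.1 hy.2.2⟩

instance Dec.eq (F G : M → M) [Fn S F] [Fn S G] : Dec S fun x => F x = G x :=
  .comp₃ (T := fun a b _ => a = b) (.eq (.var 2) (.var 1)) (by simp) (by simp) F G F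

instance Dec.lt (F G : M → M) [Fn S F] [Fn S G] : Dec S fun x => F x < G x :=
  .comp₃ (T := fun a b _ => a < b) (.lt (.var 2) (.var 1)) (by simp) (by simp) F G F

instance Dec.mem_set (A : Set M) (F : M → M) [hA : Fact (A ∈ S)] [Fn S F] :
    Dec S fun x => F x ∈ A :=
  .comp₃ (T := fun a _ _ => a ∈ A) (.mem (.var 2) ⟨A, hA.out⟩) trivial (by simp) F F F

instance Dec.mem_set_left (A : Set M) [Fact (A ∈ S)] : Dec S (Membership.mem A) :=
  Dec.mem_set A fun x => x

theorem Dec.fact {P : M → Prop} (h : Dec S P) : Fact ({x | P x} ∈ S) := ⟨h.mem⟩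

theorem Dec.comp {P : M → Prop} (h : Dec S P) (F : M → M) [Fn S F] : Dec S fun x => P (F x) :=
  have := h.fact
  Dec.mem_set {x | P x} F

instance Dec.and (P Q : M → Prop) [hP : Dec S P] [hQ : Dec S Q] : Dec S fun x => P x ∧ Q x :=
  .of_formula (.and (.mem (.var 1) ⟨_, hP.mem⟩) (.mem (.var 1) ⟨_, hQ.mem⟩)) (by simp) (by simp)

instance Dec.not (P : M → Prop) [hP : Dec S P] : Dec S fun x => ¬ P x :=
  .of_formula (.not (.mem (.var 1) ⟨_, hP.mem⟩)) (by simp) (by simp)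

instance Dec.ne (F G : M → M) [Fn S F] [Fn S G] : Dec S fun x => F x ≠ G x :=
  Dec.not fun x => F x = G x

instance Dec.const (p : Prop) : Dec S fun _ => p := by
  by_cases hp : p
  · exact .of_formula (.eq .zero .zero) (by simp) (by simp [hp])
  · exact .of_formula (.not (.eq .zero .zero)) (by simp) (by simp [hp])

instance Dec.or (P Q : M → Prop) [hP : Dec S P] [hQ : Dec S Q] : Dec S fun x => P x ∨ Q x :=
  .of_formula (.or (.mem (.var 1) ⟨_, hP.mem⟩) (.mem (.var 1) ⟨_, hQ.mem⟩)) (by simp) (by simp)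

instance (priority := low) Dec.imp (P Q : M → Prop) [hP : Dec S P] [hQ : Dec S Q] :
    Dec S fun x => P x → Q x :=
  .of_formula (.imp (.mem (.var 1) ⟨_, hP.mem⟩) (.mem (.var 1) ⟨_, hQ.mem⟩)) (by simp) (by simp)

instance Dec.iff (P Q : M → Prop) [hP : Dec S P] [hQ : Dec S Q] : Dec S fun x => P x ↔ Q x :=
  (Dec.and (fun x => P x → Q x) fun x => Q x → P x).congr fun _ => iff_iff_implies_and_implies.symm

instance Dec.le (F G : M → M) [Fn S F] [Fn S G] : Dec S fun x => F x ≤ G x :=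
  (Dec.not fun x => G x < F x).congr fun _ => not_lt

instance Dec.ball_lt (P : M → M → Prop) (t : M → M) [hP : Dec S fun w => P (fst w) (snd w)]
    [Fn S t] : Dec S fun v => ∀ x, x < t v → P x v :=
  (Dec.comp₃ (T := fun a b _ => ∀ x, x < b → pair x a ∈ {w | P (fst w) (snd w)})
    (.ball (.var 1) (.mem (.pair (.var 0) (.var 3)) ⟨_, hP.mem⟩)) trivial (by simp)
    (fun x => x) t t).congr (by simp)

/-- The graph of the composite is `Δ⁰₁`: the intermediate value `G b` may be asserted to exist below
some `y`, or tested below every `y`. -/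
theorem Fn.comp (F G : M → M) [hF : Fn S F] [hG : Fn S G] : Fn S fun x => F (G x) := by
  obtain ⟨A, hA, eA⟩ := hF.graph
  obtain ⟨B, hB, eB⟩ := hG.graph
  have main := Dec.of_formulas (S := S)
    (R := fun y w => ∃ a < w + 1, ∃ b < w + 1, w = pair a b ∧ G b < y + 1 ∧ a = F (G b))
    (Q := fun y w => ∃ a < w + 1, ∃ b < w + 1, w = pair a b ∧ (G b < y + 1 → a = F (G b)))
    (.bex (.add (.var 1) .one) (.bex (.add (.var 2) .one)
      (.and (.eq (.var 3) (.pair (.var 1) (.var 0))) (.bex (.add (.var 2) .one) (.and (.mem (.pair (.var 0) (.var 1)) ⟨B, hB⟩)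
        (.mem (.pair (.var 2) (.var 0)) ⟨A, hA⟩))))))
    (.bex (.add (.var 1) .one) (.bex (.add (.var 2) .one)
      (.and (.eq (.var 3) (.pair (.var 1) (.var 0))) (.ball (.add (.var 2) .one) (.imp (.mem (.pair (.var 0) (.var 1)) ⟨B, hB⟩)
        (.mem (.pair (.var 2) (.var 0)) ⟨A, hA⟩))))))
    (by simp) (by simp) (fun y w => ?_) (fun y w => ?_) fun w => ?_
  · refine ⟨_, main.mem, fun a b => ⟨?_, ?_⟩⟩
    · rintro ⟨y, a', -, b', -, e, -, h⟩
      obtain ⟨rfl, rfl⟩ := pair_inj.1 e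
      exact h
    · exact fun h => ⟨G b, a, lt_add_one_iff.2 (le_pair_left _ _), b,
        lt_add_one_iff.2 (le_pair_right _ _), rfl, lt_add_one_iff.2 le_rfl, h⟩
  · simp [eA, eB]
  · have (a b : M) : (∀ z < y + 1, z = G b → a = F z) ↔ (G b < y + 1 → a = F (G b)) :=
      ⟨fun h hb => h _ hb rfl, by rintro h _ hb rfl; exact h hb⟩
    simp [eA, eB, this]
  · constructor
    · rintro ⟨-, a, ha, b, hb, rfl, -, h⟩ y
      exact ⟨a, ha, b, hb, rfl, fun _ => h⟩
    · intro h
      obtain ⟨a, ha, b, hb, rfl, -⟩ := h 0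
      obtain ⟨a', -, b', -, e, h'⟩ := h (G b)
      obtain ⟨rfl, rfl⟩ := pair_inj.1 e
      exact ⟨G b, a, ha, b, hb, rfl, lt_add_one_iff.2 le_rfl, h' (lt_add_one_iff.2 le_rfl)⟩

theorem Fn.of_dec (F : M → M) (h : Dec S fun w => fst w = F (snd w)) : Fn S F :=
  ⟨_, h.mem, by simp⟩

instance Fn.fst (F : M → M) [Fn S F] : Fn S fun x => fst (F x) := .comp SOA.fst F

instance Fn.snd (F : M → M) [Fn S F] : Fn S fun x => snd (F x) := .comp SOA.snd F

instance Fn.add (F G : M → M) [Fn S F] [Fn S G] : Fn S fun x => F x + G x :=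
  have := Fn.comp (S := S) F SOA.snd
  have := Fn.comp (S := S) G SOA.snd
  .of_dec _ (.comp₃ (T := fun a b c => a = b + c) (.eq (.var 2) (.add (.var 1) (.var 0)))
    (by simp) (by simp) SOA.fst (fun w => F (SOA.snd w)) fun w => G (SOA.snd w))

instance Fn.mul (F G : M → M) [Fn S F] [Fn S G] : Fn S fun x => F x * G x :=
  have := Fn.comp (S := S) F SOA.snd
  have := Fn.comp (S := S) G SOA.snd
  .of_dec _ (.comp₃ (T := fun a b c => a = b * c) (.eq (.var 2) (.mul (.var 1) (.var 0)))
    (by simp) (by simp) SOA.fst (fun w => F (SOA.snd w)) fun w => G (SOA.snd w))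

instance Fn.pair (F G : M → M) [Fn S F] [Fn S G] : Fn S fun x => pair (F x) (G x) :=
  inferInstanceAs (Fn S fun x => (F x + G x) * (F x + G x) + F x)

/-- Substitution of functions into a binary relation. -/
theorem Dec.comp₂ {R : M → M → Prop} (h : Dec S fun w => R (SOA.fst w) (SOA.snd w)) (F G : M → M)
    [Fn S F] [Fn S G] : Dec S fun x => R (F x) (G x) :=
  (h.comp fun x => SOA.pair (F x) (G x)).congr (by simp)

instance Dec.bex_lt (P : M → M → Prop) (t : M → M) [hP : Dec S fun w => P (SOA.fst w) (SOA.snd w)]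
    [Fn S t] : Dec S fun v => ∃ x, x < t v ∧ P x v :=
  (Dec.not fun v => ∀ x, x < t v → ¬ P x v).congr fun _ => by push Not; rfl

instance Dec.ball_le (P : M → M → Prop) (t : M → M) [hP : Dec S fun w => P (SOA.fst w) (SOA.snd w)]
    [Fn S t] : Dec S fun v => ∀ x, x ≤ t v → P x v :=
  (Dec.ball_lt P fun v => t v + 1).congr fun _ => by simp only [lt_add_one_iff]

instance Dec.bex_le (P : M → M → Prop) (t : M → M) [hP : Dec S fun w => P (SOA.fst w) (SOA.snd w)]
    [Fn S t] : Dec S fun v => ∃ x, x ≤ t v ∧ P x v :=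
  (Dec.bex_lt P fun v => t v + 1).congr fun _ => by simp only [lt_add_one_iff]

instance Dec.dvd (F G : M → M) [Fn S F] [Fn S G] : Dec S fun x => F x ∣ G x := by
  refine .comp₂ (R := fun a b => a ∣ b) (.congr (P := fun w =>
    ∃ q, q ≤ SOA.snd w ∧ SOA.snd w = SOA.fst w * q) inferInstance fun w => ⟨?_, ?_⟩) F G
  · exact fun ⟨q, _, hq⟩ => ⟨q, hq⟩
  · rintro ⟨q, hq⟩
    -- A nonzero divisor forces the quotient below the dividend. For divisor `0` the dividend is `0`
    -- and any quotient works, so `0` is chosen to respect the bound.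
    rcases eq_zero_or_exists_add_one (SOA.fst w) with h0 | ⟨d, hd⟩
    · exact ⟨0, zero_le, by rw [hq, h0, zero_mul, mul_zero]⟩
    · exact ⟨q, by rw [hq, hd, add_mul, one_mul]; exact le_add_self, hq⟩

/-- `Δ⁰₁` comprehension. -/
theorem Dec.delta {R Q : M → M → Prop} (hR : Dec S fun w => R (SOA.fst w) (SOA.snd w))
    (hQ : Dec S fun w => Q (SOA.fst w) (SOA.snd w)) (h : ∀ x, (∃ y, R y x) ↔ ∀ y, Q y x) :
    Dec S fun x => ∃ y, R y x :=
  .of_formulas (.mem (.pair (.var 0) (.var 1)) ⟨_, hR.mem⟩)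
    (.mem (.pair (.var 0) (.var 1)) ⟨_, hQ.mem⟩) trivial trivial (by simp) (by simp) h

/-- `Σ⁰₁` induction. -/
theorem sigma_induction {R : M → M → Prop} (hR : Dec S fun w => R (SOA.fst w) (SOA.snd w))
    (zero : ∃ y, R y 0) (succ : ∀ x, (∃ y, R y x) → ∃ y, R y (x + 1)) (x : M) : ∃ y, R y x :=
  hS.out.induct_exists (.mem (.pair (.var 0) (.var 1)) ⟨_, hR.mem⟩) trivial (by simp) zero succ x

theorem dec_induction {P : M → Prop} (hP : Dec S P)
    (zero : P 0) (succ : ∀ x, P x → P (x + 1)) (x : M) : P x :=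
  hS.out.induct (.mem (.var 1) ⟨_, hP.mem⟩) trivial (by simp) zero succ x

/-- `Π⁰₁` induction. -/
theorem pi_induction {R : M → M → Prop} (hR : Dec S fun w => R (SOA.fst w) (SOA.snd w))
    (zero : ∀ y, R y 0) (succ : ∀ x, (∀ y, R y x) → ∀ y, R y (x + 1)) (x : M) : ∀ y, R y x := by
  by_contra hx
  push Not at hx
  -- A counterexample at `x` is pushed down: by `Σ⁰₁` induction on `b`, the property also fails at
  -- the number `c` with `c + b = x`. The case `b = x` contradicts `zero`.
  obtain ⟨p, hp⟩ := sigma_induction (S := S)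
    (R := fun p b => b ≤ x → SOA.snd p + b = x ∧ ¬ R (SOA.fst p) (SOA.snd p))
    (have := hR.comp SOA.fst; inferInstance)
    (by
      obtain ⟨y, hy⟩ := hx
      exact ⟨SOA.pair y x, fun _ => by simpa using hy⟩)
    (fun b ⟨p, hp⟩ => by
      by_cases hb : b + 1 ≤ x
      · obtain ⟨e, hn⟩ := hp ((lt_add_one_iff.2 le_rfl).le.trans hb)
        obtain ⟨c, rfl⟩ := exists_add_of_le hb
        have hc : SOA.snd p = c + 1 := by
          refine add_right_cancel (b := b) (e.trans ?_)
          ring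
        rw [hc] at hn
        have : ¬ ∀ y, R y c := fun h => hn (succ c h _)
        push Not at this
        obtain ⟨y, hy⟩ := this
        exact ⟨SOA.pair y c, fun _ => by simpa [add_comm] using hy⟩
      · exact ⟨0, fun h => (hb h).elim⟩) x
  obtain ⟨e, hn⟩ := hp le_rfl
  rw [add_eq_right.1 e] at hn
  exact hn (zero _)

/-- The least number principle. -/
theorem exists_least {P : M → Prop} (hP : Dec S P) (h : ∃ x, P x) : ∃ x, P x ∧ ∀ y < x, ¬ P y := by
  by_contra hn
  push Not at hn
  obtain ⟨x, hx⟩ := h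
  refine dec_induction (S := S) (P := fun x => ∀ y, y < x → ¬ P y)
    (have := hP.comp SOA.fst; inferInstance) (fun y hy => (not_lt_zero hy).elim)
    (fun x ih y hy hPy => ?_) (x + 1) x (lt_add_one_iff.2 le_rfl) hx
  obtain ⟨z, hz, hPz⟩ := hn y hPy
  exact ih z (hz.trans_le (lt_add_one_iff.1 hy)) hPz

end Calculus

/-! ### Binary strings coded by the β function -/

section Strings

variable {M : Type*} [CommSemiring M] [LinearOrder M] [IsStrictOrderedRing M]
  [CanonicallyOrderedAdd M] [Fact (BasicAxioms M)]

theorem dvd_right_of_dvd_add {a b c : M} (h : a ∣ b + c) (hb : a ∣ b) : a ∣ c := by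
  obtain ⟨x, rfl⟩ := hb
  obtain ⟨y, hy⟩ := h
  rcases le_total x y with hxy | hxy
  · obtain ⟨z, rfl⟩ := exists_add_of_le hxy
    rw [mul_add] at hy
    exact ⟨z, add_left_cancel hy⟩
  · obtain ⟨z, rfl⟩ := exists_add_of_le hxy
    rw [mul_add, add_assoc, add_eq_left, add_eq_zero] at hy
    rw [hy.2]
    exact dvd_zero a

theorem le_of_dvd' {a b : M} (h : a ∣ b) (hb : b ≠ 0) : a ≤ b := by
  obtain ⟨c, rfl⟩ := h
  rcases eq_zero_or_exists_add_one c with rfl | ⟨d, rfl⟩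
  · simp at hb
  · rw [mul_add, mul_one]
    exact le_add_self

/-- Distinct members of the family `m (i + 1) + 1` are coprime. -/
theorem dvd_of_dvd_beta_mul {l m j k c : M} (hm : ∀ i < l, i + 1 ∣ m) (hj : j < l) (hk : k < l)
    (hjk : j ≠ k) (h : m * (j + 1) + 1 ∣ (m * (k + 1) + 1) * c) : m * (j + 1) + 1 ∣ c := by
  -- Here `d + 1` is the distance between `j` and `k`. With `p i = m (i + 1) + 1`, the numbers `p k
  -- * (j + 1)` and `p j * (k + 1)` differ by exactly this distance; as `d + 1` divides `m`, the
  -- factor can then be removed.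
  obtain ⟨d, hd, hdvd⟩ : ∃ d < l, m * (j + 1) + 1 ∣ (d + 1) * c := by
    rcases lt_or_gt_of_ne hjk with hlt | hlt <;>
    obtain ⟨d, rfl⟩ := exists_add_of_le (add_one_le_iff.2 hlt)
    · refine ⟨d, lt_of_le_of_lt le_add_self hk,
        dvd_right_of_dvd_add (b := (m * (j + 1 + d + 1) + 1) * c * (j + 1)) ?_ (h.mul_right _)⟩
      exact ⟨(j + 1 + d + 1) * c, by ring⟩
    · refine ⟨d, lt_of_le_of_lt le_add_self hj,
        dvd_right_of_dvd_add (b := (m * (k + 1 + d + 1) + 1) * ((k + 1) * c)) ?_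
          (Dvd.intro _ rfl)⟩
      refine (h.mul_right (k + 1 + d + 1)).trans (dvd_of_eq ?_)
      ring
  obtain ⟨e, rfl⟩ := hm d hd
  refine dvd_right_of_dvd_add (b := (d + 1) * e * (j + 1) * c) ⟨c, by ring⟩ ?_
  exact (hdvd.mul_right (e * (j + 1))).trans (dvd_of_eq (by ring))

variable {S : Set (Set M)} [hS : Fact (RCA0 S)]

/-- This replaces factorials and finite products: mere existence of a common multiple is `Σ⁰₁` and
needs no recursively defined function. -/
theorem exists_common_multiple (p : M → M) (hp : Fn S p) (pos : ∀ i, p i ≠ 0) (k : M) :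
    ∃ N, N ≠ 0 ∧ ∀ i < k, p i ∣ N := by
  have := Fn.comp (S := S) p fst
  refine sigma_induction (S := S) (R := fun N k => N ≠ 0 ∧ ∀ i < k, p i ∣ N) (by infer_instance)
    ⟨1, one_ne_zero, fun i hi => (not_lt_zero hi).elim⟩ (fun k ⟨N, hN, h⟩ => ?_) k
  refine ⟨N * p k, mul_ne_zero hN (pos k), fun i hi => ?_⟩
  rcases (lt_add_one_iff.1 hi).lt_or_eq with hi | rfl
  · exact (h i hi).mul_right _
  · exact Dvd.intro_left _ rfl

/-- Take the least nonzero `n` divisible by the moduli with index in `P`. If a modulus with index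
outside `P` divided `n`, coprimality would let one cancel it and obtain a smaller such number.
Minimality also gives `n ≤ N`, which later bounds the codes of strings. -/
theorem exists_beta {l m N : M} (hm0 : m ≠ 0) (hm : ∀ i < l, i + 1 ∣ m) (hN0 : N ≠ 0)
    (hN : ∀ i < l, m * (i + 1) + 1 ∣ N) (P : M → Prop) (hP : Dec S P) :
    ∃ n ≤ N, ∀ i < l, (m * (i + 1) + 1 ∣ n ↔ P i) := by
  have := hP.comp fst
  obtain ⟨n, ⟨hn0, hn⟩, least⟩ := exists_least (S := S)
    (P := fun n => n ≠ 0 ∧ ∀ i < l, P i → m * (i + 1) + 1 ∣ n) (by infer_instance)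
    ⟨N, hN0, fun i hi _ => hN i hi⟩
  refine ⟨n, ?_, fun j hj => ⟨fun hdvd => ?_, hn j hj⟩⟩
  · by_contra hlt
    exact least N (not_le.1 hlt) ⟨hN0, fun i hi _ => hN i hi⟩
  · by_contra hPj
    obtain ⟨q, rfl⟩ := hdvd
    have hq0 : q ≠ 0 := right_ne_zero_of_mul hn0
    refine least q ?_ ⟨hq0, fun i hi hPi => dvd_of_dvd_beta_mul hm hi hj ?_ (hn i hi hPi)⟩
    · rw [add_mul, one_mul]
      refine lt_add_of_pos_left q (pos_iff_ne_zero.2 (mul_ne_zero (mul_ne_zero hm0 ?_) hq0))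
      exact (add_pos_of_nonneg_of_pos zero_le zero_lt_one).ne'
    · rintro rfl
      exact hPj hPi

/-- `c` is a triple. -/
def IsCode (c : M) : Prop := c = pair (fst c) (pair (fst (snd c)) (snd (snd c)))

/-- The length of a string. -/
noncomputable def len (c : M) : M := fst c

instance Fn.len₀ : Fn S (len : M → M) := Fn.fst₀

theorem isCode_pair (l m n : M) : IsCode (pair l (pair m n)) := by simp [IsCode]

theorem hasLength_iff {c l : M} : HasLength c l ↔ IsCode c ∧ l = len c := by
  constructor
  · rintro ⟨m, n, rfl⟩
    exact ⟨isCode_pair _ _ _, (fst_pair _ _).symm⟩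
  · rintro ⟨h, rfl⟩
    exact ⟨_, _, h⟩

theorem hasOne_iff {c i : M} : HasOne c i ↔
    IsCode c ∧ i < len c ∧ fst (snd c) * (i + 1) + 1 ∣ snd (snd c) := by
  constructor
  · rintro ⟨l, m, n, rfl, hi, hq⟩
    exact ⟨isCode_pair _ _ _, by simpa [len] using hi,
      by simpa [Dvd.dvd] using hq⟩
  · rintro ⟨h, hi, hq⟩
    exact ⟨_, _, _, h, hi, hq⟩

instance Fn.len (F : M → M) [Fn S F] : Fn S fun x => len (F x) := Fn.fst F

instance Dec.isCode₀ : Dec S (IsCode : M → Prop) :=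
  inferInstanceAs (Dec S fun c => c = SOA.pair (SOA.fst c)
    (SOA.pair (SOA.fst (SOA.snd c)) (SOA.snd (SOA.snd c))))

instance Dec.isCode (F : M → M) [Fn S F] : Dec S fun x => IsCode (F x) :=
  Dec.isCode₀.comp F

instance Dec.hasOne (F G : M → M) [Fn S F] [Fn S G] : Dec S fun x => HasOne (F x) (G x) := by
  refine .comp₂ ?_ F G
  simp only [hasOne_iff]
  infer_instance

instance Dec.hasOne_left (σ : M) : Dec S (HasOne σ) := Dec.hasOne (fun _ => σ) fun x => x

/-- The numbers `d` and `c` code the same string. -/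
def SameString (d c : M) : Prop := IsCode d ∧ len d = len c ∧ ∀ i < len c, HasOne d i ↔ HasOne c i

/-- All quantifiers become bounded here, which makes the set of strings a member of `S`. -/
theorem isString_iff {c : M} : IsString c ↔ IsCode c ∧ ∀ d < c, ¬ SameString d c := by
  simp only [IsString, hasLength_iff, exists_and_left, exists_eq, and_true]
  refine and_congr_right fun hc => forall₂_congr fun d _ => not_congr ?_
  simp only [hc, true_and]
  constructor
  · rintro ⟨h1, h2⟩
    exact ⟨((h1 (len c)).2 rfl).1, ((h1 (len c)).2 rfl).2.symm, fun i _ => h2 i⟩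
  · rintro ⟨hd, e, h⟩
    refine ⟨fun l => by simp [hd, e], fun i => ?_⟩
    by_cases hi : i < len c
    · exact h i hi
    · simp [hasOne_iff, e, hi]

instance Dec.sameString (F G : M → M) [Fn S F] [Fn S G] :
    Dec S fun x => SameString (F x) (G x) := by
  refine .comp₂ ?_ F G
  simp only [SameString]
  infer_instance

instance Dec.isString₀ : Dec S (IsString : M → Prop) :=
  Dec.congr (P := fun c => IsCode c ∧ ∀ d < c, ¬ SameString d c) (by infer_instance)
    fun _ => isString_iff.symm

instance Dec.isString (F : M → M) [Fn S F] : Dec S fun x => IsString (F x) := Dec.isString₀.comp F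

theorem IsString.isCode {c : M} (h : IsString c) : IsCode c := (isString_iff.1 h).1

theorem IsString.hasLength {c : M} (h : IsString c) : HasLength c (len c) :=
  hasLength_iff.2 ⟨h.isCode, rfl⟩

theorem HasOne.lt_len {c i : M} (h : HasOne c i) : i < len c := (hasOne_iff.1 h).2.1

theorem isPrefix_iff {σ τ : M} : IsPrefix σ τ ↔ IsCode σ ∧ IsCode τ ∧ len σ ≤ len τ ∧
    ∀ i < len σ, HasOne σ i ↔ HasOne τ i := by
  simp only [IsPrefix, hasLength_iff, ← le_iff_lt_or_eq]
  constructor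
  · rintro ⟨_, _, ⟨h1, rfl⟩, ⟨h2, rfl⟩, h⟩
    exact ⟨h1, h2, h⟩
  · rintro ⟨h1, h2, h⟩
    exact ⟨_, _, ⟨h1, rfl⟩, ⟨h2, rfl⟩, h⟩

instance Dec.isPrefix (F G : M → M) [Fn S F] [Fn S G] : Dec S fun x => IsPrefix (F x) (G x) := by
  refine .comp₂ ?_ F G
  simp only [isPrefix_iff]
  infer_instance

theorem isInitSeg_iff {σ : M} {X : Set M} : IsInitSeg σ X ↔ IsCode σ ∧
    ∀ i < len σ, HasOne σ i ↔ i ∈ X := by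
  simp only [IsInitSeg, hasLength_iff]
  constructor
  · rintro ⟨_, ⟨h1, rfl⟩, h⟩
    exact ⟨h1, h⟩
  · rintro ⟨h1, h⟩
    exact ⟨_, ⟨h1, rfl⟩, h⟩

theorem IsString.ext {σ τ : M} (hσ : IsString σ) (hτ : IsString τ) (hl : len σ = len τ)
    (h : ∀ i < len σ, HasOne σ i ↔ HasOne τ i) : σ = τ := by
  rcases lt_trichotomy σ τ with hlt | rfl | hlt
  · exact ((isString_iff.1 hτ).2 σ hlt ⟨hσ.isCode, hl, fun i hi => h i (hl ▸ hi)⟩).elim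
  · rfl
  · exact ((isString_iff.1 hσ).2 τ hlt ⟨hτ.isCode, hl.symm, fun i hi => (h i hi).symm⟩).elim

/-- `y` codes a string of ones in such a way that all strings of at most the same length have codes
that are at most `y`. -/
def IsBound (y : M) : Prop := IsCode y ∧ fst (snd y) ≠ 0 ∧ snd (snd y) ≠ 0 ∧
  (∀ i < len y, i + 1 ∣ fst (snd y)) ∧ ∀ i < len y, fst (snd y) * (i + 1) + 1 ∣ snd (snd y)

instance Dec.isBound₀ : Dec S (IsBound : M → Prop) :=
  Dec.congr (P := fun y => IsCode y ∧ fst (snd y) ≠ 0 ∧ snd (snd y) ≠ 0 ∧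
    (∀ i < len y, i + 1 ∣ fst (snd y)) ∧ ∀ i < len y, fst (snd y) * (i + 1) + 1 ∣ snd (snd y))
    (by infer_instance) fun _ => Iff.rfl

instance Dec.isBound (F : M → M) [Fn S F] : Dec S fun x => IsBound (F x) := Dec.isBound₀.comp F

theorem exists_isBound (S : Set (Set M)) [Fact (RCA0 S)] (l : M) :
    ∃ y : M, IsBound y ∧ len y = l := by
  obtain ⟨m, hm0, hm⟩ := exists_common_multiple (S := S) (fun i => i + 1) (by infer_instance)
    (fun i => (add_pos_of_nonneg_of_pos zero_le zero_lt_one).ne') l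
  obtain ⟨N, hN0, hN⟩ := exists_common_multiple (S := S) (fun i => m * (i + 1) + 1) (by infer_instance)
    (fun i => (add_pos_of_nonneg_of_pos zero_le zero_lt_one).ne') l
  exact ⟨pair l (pair m N), ⟨isCode_pair _ _ _, by simpa using hm0, by simpa using hN0,
    by simpa [len] using hm, by simpa [len] using hN⟩, by simp [len]⟩

theorem IsBound.exists_code {y : M} (hy : IsBound y) {l : M} (hl : l ≤ len y) (P : M → Prop)
    (hP : Dec S P) : ∃ c ≤ y, IsCode c ∧ len c = l ∧ ∀ i < l, HasOne c i ↔ P i := by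
  obtain ⟨hc, hm0, hN0, hm, hN⟩ := hy
  obtain ⟨n, hn, h⟩ := exists_beta (S := S) hm0 (fun i hi => hm i (hi.trans_le hl)) hN0
    (fun i hi => hN i (hi.trans_le hl)) P hP
  refine ⟨pair l (pair (fst (snd y)) n), ?_, isCode_pair _ _ _, by simp [len], fun i hi => ?_⟩
  · conv_rhs => rw [hc]
    gcongr
    exact hl
  · simp [hasOne_iff, isCode_pair, len, hi, h i hi]

/-- The string has some code at most `y`, built from the moduli of `y`, and `σ` is the least of its
codes. Thus quantifiers over strings of given length can be bounded. -/
theorem IsBound.le (S : Set (Set M)) [Fact (RCA0 S)] {y σ : M} (hy : IsBound y) (hσ : IsString σ)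
    (hl : len σ ≤ len y) : σ ≤ y := by
  obtain ⟨c, hcy, hc, e, h⟩ := hy.exists_code (S := S) hl (fun i => HasOne σ i) (by infer_instance)
  by_contra hlt
  exact (isString_iff.1 hσ).2 c (hcy.trans_lt (not_le.1 hlt)) ⟨hc, e, h⟩

theorem exists_string (P : M → Prop) (hP : Dec S P) (l : M) :
    ∃ σ, IsString σ ∧ len σ = l ∧ ∀ i < l, HasOne σ i ↔ P i := by
  obtain ⟨y, hy, rfl⟩ := exists_isBound S l
  obtain ⟨c, -, hc, e, h⟩ := hy.exists_code (S := S) le_rfl P hP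
  obtain ⟨σ, ⟨h1, h2, h3⟩, least⟩ := exists_least (S := S) (P := fun σ => SameString σ c)
    (by infer_instance) ⟨c, hc, rfl, fun _ _ => Iff.rfl⟩
  refine ⟨σ, isString_iff.2 ⟨h1, fun d hd hdσ => least d hd ?_⟩, h2.trans e, fun i hi => ?_⟩
  · exact ⟨hdσ.1, hdσ.2.1.trans h2, fun i hi => (hdσ.2.2 i (h2 ▸ hi)).trans (h3 i hi)⟩
  · exact (h3 i (e ▸ hi)).trans (h i hi)

end Strings

/-! ### Arithmetical comprehension as closure under number quantifiers -/

section Comprehension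

variable {M : Type*} [CommSemiring M] [LinearOrder M] [IsStrictOrderedRing M]
  [CanonicallyOrderedAdd M] [Fact (BasicAxioms M)] {S : Set (Set M)} [hS : Fact (RCA0 S)]

theorem Term.fn_val {n : ℕ} (g : Fin n → M → M) (hg : ∀ i, Fn S (g i)) (t : Term M n) :
    Fn S fun x => t.val fun i => g i x := by
  induction t with
  | var i => exact hg i
  | param a => exact Fn.const a
  | zero => exact Fn.const 0
  | one => exact Fn.const 1
  | add s t hs ht => exact Fn.add _ _
  | mul s t hs ht => exact Fn.mul _ _

/-- Only the unbounded quantifier needs the hypothesis `H`. The functions `g` stand for the free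
variables, so that under a quantifier the variables can be packed into a single number. -/
theorem Formula.dec_holds
    (H : ∀ P : M → M → Prop, (Dec S fun w => P (fst w) (snd w)) → Dec S fun x => ∀ y, P y x)
    {n : ℕ} (φ : Formula S n) (g : Fin n → M → M) (hg : ∀ i, Fn S (g i)) :
    Dec S fun x => φ.Holds fun i => g i x := by
  have cons {n : ℕ} (φ : Formula S (n + 1)) (ih : ∀ g : Fin (n + 1) → M → M, (∀ i, Fn S (g i)) →
      Dec S fun x => φ.Holds fun i => g i x) (g : Fin n → M → M) (hg : ∀ i, Fn S (g i)) :
      Dec S fun w => φ.Holds (Fin.cons (fst w) fun i => g i (snd w)) := by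
    refine (ih (Fin.cons fst fun i w => g i (snd w)) fun i => ?_).congr fun w => ?_
    · refine Fin.cases ?_ (fun i => ?_) i
      · exact Fn.fst₀
      · have := hg i
        exact Fn.comp (g i) snd
    · refine iff_of_eq (congrArg φ.Holds (funext fun i => ?_))
      refine Fin.cases rfl (fun i => rfl) i
  induction φ with
  | eq s t =>
    have := s.fn_val g hg
    have := t.fn_val g hg
    exact Dec.eq (fun x => s.val fun i => g i x) fun x => t.val fun i => g i x
  | lt s t =>
    have := s.fn_val g hg
    have := t.fn_val g hg
    exact Dec.lt (fun x => s.val fun i => g i x) fun x => t.val fun i => g i x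
  | mem t X =>
    have := t.fn_val g hg
    have : Fact (X.1 ∈ S) := ⟨X.2⟩
    exact Dec.mem_set X.1 fun x => t.val fun i => g i x
  | not φ ih =>
    have := ih g hg
    exact Dec.not fun x => φ.Holds fun i => g i x
  | and φ ψ ih ih' =>
    have := ih g hg
    have := ih' g hg
    exact Dec.and (fun x => φ.Holds fun i => g i x) fun x => ψ.Holds fun i => g i x
  | ball t φ ih =>
    have := t.fn_val g hg
    have := cons φ ih g hg
    exact Dec.ball_lt (fun y x => φ.Holds (Fin.cons y fun i => g i x)) fun x => t.val fun i => g i x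
  | all φ ih =>
    exact H (fun y x => φ.Holds (Fin.cons y fun i => g i x)) (cons φ ih g hg)

/-- Arithmetical comprehension follows from `Σ⁰₁` comprehension. -/
theorem ACA.of_exists (h : ∀ R ∈ S, Dec S fun x => ∃ y, pair y x ∈ R) : ACA S := fun φ => by
  have key := φ.dec_holds (fun P hP => ?_) (fun _ x => x) fun _ => Fn.id
  · refine (key.congr (Q := fun x => φ.Holds ![x]) fun x => iff_of_eq (congrArg φ.Holds ?_)).mem
    funext i
    simp
  · have := h _ (Dec.not fun w => P (fst w) (snd w)).mem
    exact (Dec.not fun x => ∃ y, pair y x ∈ {w | ¬ P (fst w) (snd w)}).congr (by simp)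

/-- Under ACA this makes `dec_induction` and `exists_least` available for all arithmetical
predicates. -/
instance Dec.all [hA : Fact (ACA S)] (P : M → M → Prop) [hP : Dec S fun w => P (fst w) (snd w)] :
    Dec S fun x => ∀ y, P y x :=
  ⟨by simpa using hA.out (.all (.mem (.pair (.var 0) (.var 1)) ⟨_, hP.mem⟩))⟩

instance Dec.exists [hA : Fact (ACA S)] (P : M → M → Prop)
    [hP : Dec S fun w => P (fst w) (snd w)] : Dec S fun x => ∃ y, P y x :=
  (Dec.not fun x => ∀ y, ¬ P y x).congr fun _ => by push Not; rfl

end Comprehension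

/-! ### Paths and compactness -/

section Paths

variable {M : Type*} [CommSemiring M] [LinearOrder M] [IsStrictOrderedRing M]
  [CanonicallyOrderedAdd M] [Fact (BasicAxioms M)] {S : Set (Set M)} [hS : Fact (RCA0 S)]

theorem IsInitSeg.hasOne_iff {σ i : M} {X : Set M} (h : IsInitSeg σ X) :
    HasOne σ i ↔ i < len σ ∧ i ∈ X :=
  ⟨fun hi => ⟨hi.lt_len, ((isInitSeg_iff.1 h).2 i hi.lt_len).1 hi⟩,
    fun hi => ((isInitSeg_iff.1 h).2 i hi.1).2 hi.2⟩

theorem exists_isInitSeg {X : Set M} (hX : X ∈ S) (l : M) :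
    ∃ σ, IsString σ ∧ len σ = l ∧ IsInitSeg σ X := by
  obtain ⟨σ, h1, h2, h3⟩ := exists_string (S := S) (fun i => i ∈ X) ⟨hX⟩ l
  exact ⟨σ, h1, h2, isInitSeg_iff.2 ⟨h1.isCode, fun i hi => h3 i (h2 ▸ hi)⟩⟩

theorem IsCode.len_le {σ : M} (h : IsCode σ) : len σ ≤ σ := by
  conv_rhs => rw [h]
  exact le_pair_left _ _

/-- By `WKL`, a tree with nodes of all lengths has a path. -/
theorem WKL.nonempty_paths (hW : WKL S) {T : Set M} (hT : T ∈ S) (tree : IsTree T)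
    (h : ∀ l, ∃ σ ∈ T, l ≤ len σ) : (paths S T).Nonempty :=
  hW T hT tree fun k => by
    obtain ⟨σ, hσ, hl⟩ := h (k + 1)
    exact ⟨σ, hσ, (add_one_le_iff.1 hl).trans_le (tree.isString σ hσ).isCode.len_le⟩

theorem paths_mono {T T' : Set M} (h : T ⊆ T') : paths S T ⊆ paths S T' :=
  fun _ hX => ⟨hX.1, fun σ hσ hi => h (hX.2 σ hσ hi)⟩

/-- If no path through a tree contains `p` then, at some level, no node of the tree does. -/
theorem WKL.exists_isBound_forall (hW : WKL S) {T : Set M} (hT : T ∈ S) (tree : IsTree T) {p : M}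
    (h : ∀ X ∈ paths S T, p ∉ X) :
    ∃ y, IsBound y ∧ p < len y ∧ ∀ τ ≤ y, τ ∈ T → len τ = len y → ¬ HasOne τ p := by
  by_contra! hn
  have : Fact (T ∈ S) := ⟨hT⟩
  -- The subtree of nodes that do not exclude `p`: were it infinite, WKL would give a path through
  -- `T` containing `p`.
  have hdec : Dec S fun τ => τ ∈ T ∧ (p < len τ → HasOne τ p) := inferInstance
  obtain ⟨X, hX⟩ := hW.nonempty_paths hdec.mem
    ⟨fun σ hσ => tree.isString σ hσ.1, fun τ hτ σ hσ hp => ⟨tree.prefix_mem τ hτ.1 σ hσ hp,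
      fun hlt => ((isPrefix_iff.1 hp).2.2.2 p hlt).2 (hτ.2 (hlt.trans_le (isPrefix_iff.1 hp).2.2.1))⟩⟩
    fun l => by
      obtain ⟨y, hy, hl⟩ := exists_isBound S (l + (p + 1))
      obtain ⟨τ, -, hτ, e, h1⟩ := hn y hy (by
        rw [hl]
        exact (lt_add_one_iff.2 le_rfl).trans_le le_add_self)
      exact ⟨τ, ⟨hτ, fun _ => h1⟩, by rw [e, hl]; exact le_self_add⟩
  refine h X (paths_mono (fun τ hτ => hτ.1) hX) ?_
  obtain ⟨σ, h1, h2, h3⟩ := exists_isInitSeg hX.1 (p + 1)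
  exact (h3.hasOne_iff.1 ((hX.2 σ h1 h3).2 (by rw [h2]; exact lt_add_one_iff.2 le_rfl))).2

end Paths

/-! ### Minimal subsystems of row shifts imply ACA -/

section RowShift

variable {M : Type*} [CommSemiring M] [LinearOrder M] [IsStrictOrderedRing M]
  [CanonicallyOrderedAdd M] [Fact (BasicAxioms M)] {S : Set (Set M)} [hS : Fact (RCA0 S)]

instance Fn.ite (P : M → Prop) [∀ x, Decidable (P x)] (F G : M → M) [hP : Dec S P] [Fn S F] [Fn S G] :
    Fn S fun x => if P x then F x else G x := by
  have := hP.comp SOA.snd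
  have := Fn.comp (S := S) F SOA.snd
  have := Fn.comp (S := S) G SOA.snd
  refine .of_dec _ (.congr (P := fun w => (P (SOA.snd w) → SOA.fst w = F (SOA.snd w)) ∧
    (¬ P (SOA.snd w) → SOA.fst w = G (SOA.snd w))) inferInstance fun w => ?_)
  by_cases h : P (SOA.snd w) <;> simp [h]

/-- Subsets of `M` are regarded as sequences of rows, the `j`-th entry of the `n`-th row being at
position `pair n j`. This map on positions moves by `b` entries in each row. -/
noncomputable def advance (b p : M) : M :=
  if p = pair (fst p) (snd p) then pair (fst p) (snd p + b) else p

instance Fn.advance (F G : M → M) [Fn S F] [Fn S G] : Fn S fun x => advance (F x) (G x) :=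
  Fn.ite (fun x => G x = SOA.pair (SOA.fst (G x)) (SOA.snd (G x)))
    (fun x => SOA.pair (SOA.fst (G x)) (SOA.snd (G x) + F x)) G

instance Fn.advance_left (b : M) : Fn S (SOA.advance b) := Fn.advance (fun _ => b) fun x => x

@[simp]
theorem advance_pair (b n j : M) : advance b (pair n j) = pair n (j + b) := by simp [advance]

@[simp]
theorem advance_zero (p : M) : advance 0 p = p := by
  unfold advance
  split_ifs with h
  · rw [add_zero, ← h]
  · rfl

theorem advance_advance (b c p : M) : advance b (advance c p) = advance (c + b) p := by
  by_cases h : p = pair (fst p) (snd p)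
  · rw [h, advance_pair, advance_pair, advance_pair, add_assoc]
  · rw [advance, advance, advance, if_neg h, if_neg h, if_neg h]

/-- Moving one entry along a row increases the position by `2 (n + j) + 1`, and `n + j ≤ (n + j)² ≤
p`. Hence a string of length `3 l` determines the first `l` bits of its shift, the origin of the
factor 3 in `rowShift`. -/
theorem advance_one_le (p : M) : advance 1 p ≤ 3 * p + 1 := by
  by_cases h : p = pair (fst p) (snd p)
  · generalize fst p = n at h
    generalize snd p = j at h
    have h1 : n + j ≤ p := h ▸ (le_mul_self' _).trans le_self_add
    calc advance 1 p = p + 2 * (n + j) + 1 := by rw [h, advance_pair]; unfold pair; ring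
      _ ≤ p + 2 * p + 1 := by gcongr
      _ = 3 * p + 1 := by ring
  · rw [advance, if_neg h]
    refine le_trans ?_ le_self_add
    rw [show 3 * p = p + 2 * p by ring]
    exact le_self_add

theorem advance_one_lt {i l : M} (h : i < l) : advance 1 i < 3 * l :=
  calc advance 1 i ≤ 3 * i + 1 := advance_one_le i
    _ < 3 * (i + 1) := by
      rw [show 3 * (i + 1) = 3 * i + 1 + 2 by ring]
      exact lt_add_of_pos_right _ two_pos
    _ ≤ 3 * l := by
      gcongr
      exact add_one_le_iff.2 h

theorem exists_third (S : Set (Set M)) [Fact (RCA0 S)] (a : M) :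
    ∃ l : M, 3 * l ≤ a ∧ a < 3 * l + 3 := by
  refine sigma_induction (S := S) (R := fun l a => 3 * l ≤ a ∧ a < 3 * l + 3) (by infer_instance)
    ⟨0, by simp⟩ (fun a ⟨l, h1, h2⟩ => ?_) a
  rcases (add_one_le_iff.2 h2).lt_or_eq with h | h
  · exact ⟨l, h1.trans le_self_add, h⟩
  · exact ⟨l + 1, by rw [h, mul_add, mul_one], by rw [h, mul_add, mul_one]; simp⟩

theorem third_le {a b l k : M} (h1 : 3 * l ≤ a) (hab : a ≤ b) (h2 : b < 3 * k + 3) : l ≤ k := by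
  rw [← lt_add_one_iff]
  have : 3 * l < 3 * (k + 1) := by
    rw [mul_add, mul_one]
    exact (h1.trans hab).trans_lt h2
  exact lt_of_mul_lt_mul_left this zero_le

/-- The transformation shifting all rows, as a function on strings. -/
def rowShift (M : Type*) [CommSemiring M] [LinearOrder M] : Set M :=
  {p | p = pair (fst p) (snd p) ∧ IsString (fst p) ∧ IsString (snd p) ∧
    3 * len (snd p) ≤ len (fst p) ∧ len (fst p) < 3 * len (snd p) + 3 ∧
    ∀ i < len (snd p), HasOne (snd p) i ↔ HasOne (fst p) (advance 1 i)}

theorem pair_mem_rowShift {σ τ : M} : pair σ τ ∈ rowShift M ↔ IsString σ ∧ IsString τ ∧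
    3 * len τ ≤ len σ ∧ len σ < 3 * len τ + 3 ∧ ∀ i < len τ, HasOne τ i ↔ HasOne σ (advance 1 i) := by
  simp [rowShift]

theorem rowShift_mem : rowShift M ∈ S := by
  have : Dec S fun p => p = pair (fst p) (snd p) ∧ IsString (fst p) ∧ IsString (snd p) ∧
    3 * len (snd p) ≤ len (fst p) ∧ len (fst p) < 3 * len (snd p) + 3 ∧
    ∀ i < len (snd p), HasOne (snd p) i ↔ HasOne (fst p) (advance 1 i) := by infer_instance
  exact this.mem

theorem exists_pair_mem_rowShift (S : Set (Set M)) [Fact (RCA0 S)]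
    {σ : M} (hσ : IsString σ) : ∃ τ, pair σ τ ∈ rowShift M := by
  obtain ⟨l, h1, h2⟩ := exists_third S (len σ)
  obtain ⟨τ, hτ, rfl, h⟩ := exists_string (S := S) (fun i => HasOne σ (advance 1 i))
    (by infer_instance) l
  exact ⟨τ, pair_mem_rowShift.2 ⟨hσ, hτ, h1, h2, h⟩⟩

theorem encodesTransformation_rowShift (S : Set (Set M)) [Fact (RCA0 S)] :
    EncodesTransformation (rowShift M) where
  graph p hp := ⟨fst p, snd p, hp.2.1, hp.2.2.1, hp.1⟩
  total σ hσ := by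
    refine existsUnique_of_exists_of_unique (exists_pair_mem_rowShift S hσ) fun τ τ' h h' => ?_
    obtain ⟨-, hτ, h1, h2, h3⟩ := pair_mem_rowShift.1 h
    obtain ⟨-, hτ', h1', h2', h3'⟩ := pair_mem_rowShift.1 h'
    have e := le_antisymm (third_le h1 le_rfl h2') (third_le h1' le_rfl h2)
    exact hτ.ext hτ' e fun i hi => (h3 i hi).trans (h3' i (e ▸ hi)).symm
  order_preserving σ σ' τ τ' hσ hτ h := by
    obtain ⟨-, h0, h1, -, h3⟩ := pair_mem_rowShift.1 hσ
    obtain ⟨-, h0', -, h2', h3'⟩ := pair_mem_rowShift.1 hτ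
    obtain ⟨-, -, hl, hb⟩ := isPrefix_iff.1 h
    have hle := third_le h1 hl h2'
    refine isPrefix_iff.2 ⟨h0.isCode, h0'.isCode, hle, fun i hi => ?_⟩
    rw [h3 i hi, h3' i (hi.trans_le hle), hb _ ((advance_one_lt hi).trans_le h1)]
  length_unbounded l := by
    refine ⟨3 * l, fun σ τ h hl => ?_⟩
    obtain ⟨-, h0, -, h2, -⟩ := pair_mem_rowShift.1 h
    exact ⟨len τ, h0.hasLength,
      le_iff_lt_or_eq.1 (third_le le_rfl (hasLength_iff.1 hl).2.le h2)⟩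
  length_lt σ τ h k l hk hl hk0 := by
    obtain ⟨-, -, h1, -, -⟩ := pair_mem_rowShift.1 h
    rw [← (hasLength_iff.1 hk).2, ← (hasLength_iff.1 hl).2] at h1
    rcases eq_or_ne l 0 with rfl | hl0
    · exact pos_iff_ne_zero.2 hk0
    · refine lt_of_lt_of_le ?_ h1
      rw [show 3 * l = l + 2 * l by ring]
      exact lt_add_of_pos_right _ (mul_pos two_pos (pos_iff_ne_zero.2 hl0))

/-- The transformation of paths induced by `rowShift` preserves subsystems. -/
theorem IsSystem.advance_mem_paths {D : Set M} (h : IsSystem S D (rowShift M)) {X : Set M}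
    (hX : X ∈ paths S D) : {p | advance 1 p ∈ X} ∈ paths S D := by
  have : Fact (X ∈ S) := ⟨hX.1⟩
  have hdec : Dec S fun p => advance 1 p ∈ X := inferInstance
  refine ⟨hdec.mem, fun τ hτ hi => ?_⟩
  obtain ⟨σ, hσ, hl, hσX⟩ := exists_isInitSeg hX.1 (3 * len τ)
  refine h.map_closed σ (hX.2 σ hσ hσX) τ (pair_mem_rowShift.2 ⟨hσ, hτ, hl.ge, ?_, fun i hlt => ?_⟩)
  · rw [hl]
    exact lt_add_of_pos_right _ three_pos
  · rw [hi.hasOne_iff, hσX.hasOne_iff, hl]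
    exact ⟨fun h => ⟨advance_one_lt hlt, h.2⟩, fun h => ⟨hlt, h.2⟩⟩

/-- Since `b` may be nonstandard, the shift cannot be iterated externally. Being a path is a `Π⁰₁`
condition on the initial segments, so `pi_induction` on `b` applies. -/
theorem IsSystem.advance_mem_paths' {D : Set M} (h : IsSystem S D (rowShift M)) {X : Set M}
    (hX : X ∈ paths S D) (b : M) : {p | advance b p ∈ X} ∈ paths S D := by
  have : Fact (X ∈ S) := ⟨hX.1⟩
  have : Fact (D ∈ S) := ⟨h.tree_mem⟩
  have hdec (b : M) : Dec S fun p => advance b p ∈ X := inferInstance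
  have key := pi_induction (S := S)
    (R := fun σ b => IsString σ → (∀ i < len σ, HasOne σ i ↔ advance b i ∈ X) → σ ∈ D)
    (by infer_instance)
    (fun σ hσ hi => hX.2 σ hσ (isInitSeg_iff.2 ⟨hσ.isCode, by simpa using hi⟩))
    (fun b ih σ hσ hi => ?_) b
  · exact ⟨(hdec b).mem, fun σ hσ hi => key σ hσ (isInitSeg_iff.1 hi).2⟩
  · refine (h.advance_mem_paths (X := {p | advance b p ∈ X})
      ⟨(hdec b).mem, fun σ hσ hi => ih σ hσ (isInitSeg_iff.1 hi).2⟩).2 σ hσ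
      (isInitSeg_iff.2 ⟨hσ.isCode, ?_⟩)
    simpa [advance_advance, add_comm] using hi

/-- The tree of all strings whose `n`-th row contains a `1` in each window of length `s + 1`
whenever `pair s n ∈ R`, and contains two ones at distance `d` only if there is such an `s ≤ d`. -/
def rowTree (R : Set M) : Set M :=
  {σ | IsString σ ∧
    (∀ n a d, d ≠ 0 → HasOne σ (pair n a) → HasOne σ (pair n (a + d)) → ∃ s ≤ d, pair s n ∈ R) ∧
    ∀ n a s, pair s n ∈ R → pair n (a + s) < len σ → ∃ b ≤ s, HasOne σ (pair n (a + b))}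

variable {R : Set M}

theorem rowTree_mem (hR : R ∈ S) : rowTree R ∈ S := by
  have : Fact (R ∈ S) := ⟨hR⟩
  refine (Dec.congr (S := S) (P := fun σ => IsString σ ∧
    (∀ n < len σ, ∀ a < len σ, ∀ d < len σ, d ≠ 0 → HasOne σ (pair n a) →
      HasOne σ (pair n (a + d)) → ∃ s ≤ d, pair s n ∈ R) ∧
    ∀ n < len σ, ∀ a < len σ, ∀ s < len σ, pair s n ∈ R → pair n (a + s) < len σ →
      ∃ b ≤ s, HasOne σ (pair n (a + b))) (by infer_instance) fun σ => ?_).mem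
  refine and_congr_right fun _ => and_congr ⟨fun h n a d hd h1 h2 => ?_, fun h n _ a _ d _ => h n a d⟩
    ⟨fun h n a s hs hl => ?_, fun h n _ a _ s _ => h n a s⟩
  · have hlt := le_pair_right n (a + d)
    exact h n ((le_pair_left n _).trans_lt h2.lt_len) a ((le_self_add.trans hlt).trans_lt h2.lt_len)
      d ((le_add_self.trans hlt).trans_lt h2.lt_len) hd h1 h2
  · have hlt := le_pair_right n (a + s)
    exact h n ((le_pair_left n _).trans_lt hl) a ((le_self_add.trans hlt).trans_lt hl)
      s ((le_add_self.trans hlt).trans_lt hl) hs hl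

theorem isTree_rowTree : IsTree (rowTree R) where
  isString σ hσ := hσ.1
  prefix_mem τ hτ σ hσ h := by
    obtain ⟨-, -, hl, hb⟩ := isPrefix_iff.1 h
    refine ⟨hσ, fun n a d hd h1 h2 => ?_, fun n a s hs hlt => ?_⟩
    · exact hτ.2.1 n a d hd ((hb _ h1.lt_len).1 h1) ((hb _ h2.lt_len).1 h2)
    · obtain ⟨b, hbs, h1⟩ := hτ.2.2 n a s hs (hlt.trans_le hl)
      refine ⟨b, hbs, (hb _ (lt_of_le_of_lt ?_ hlt)).2 h1⟩
      gcongr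

theorem rowTree_closed {σ τ : M} (hσ : σ ∈ rowTree R) (h : pair σ τ ∈ rowShift M) :
    τ ∈ rowTree R := by
  obtain ⟨-, hτ, h1, h2, h3⟩ := pair_mem_rowShift.1 h
  refine ⟨hτ, fun n a d hd ha had => ?_, fun n a s hs hlt => ?_⟩
  · have ha' := (h3 _ ha.lt_len).1 ha
    have had' := (h3 _ had.lt_len).1 had
    rw [advance_pair] at ha' had'
    exact hσ.2.1 n (a + 1) d hd ha' (by rwa [add_right_comm])
  · have hlt' := (advance_one_lt hlt).trans_le h1
    rw [advance_pair, add_right_comm] at hlt'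
    obtain ⟨b, hb, hone⟩ := hσ.2.2 n (a + 1) s hs hlt'
    refine ⟨b, hb, (h3 _ (lt_of_le_of_lt ?_ hlt)).2 ?_⟩
    · gcongr
    · rwa [advance_pair, add_right_comm]

theorem exists_dvd_add (S : Set (Set M)) [Fact (RCA0 S)] (s a : M) :
    ∃ b ≤ s, s + 1 ∣ a + b + 1 := by
  refine dec_induction (S := S) (P := fun a => ∃ b ≤ s, s + 1 ∣ a + b + 1) (by infer_instance)
    ⟨s, le_rfl, by rw [zero_add]⟩ (fun a ⟨b, hb, h⟩ => ?_) a
  rcases eq_zero_or_exists_add_one b with rfl | ⟨c, rfl⟩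
  · refine ⟨s, le_rfl, ?_⟩
    rw [add_zero] at h
    rw [add_assoc]
    exact dvd_add h dvd_rfl
  · exact ⟨c, le_self_add.trans hb, by rwa [add_right_comm a, add_assoc a]⟩

/-- If `s` is the least witness for `n`, make row `n` periodic with period `s + 1`; leave
unwitnessed rows empty. -/
theorem paths_rowTree_nonempty (hR : R ∈ S) : (paths S (rowTree R)).Nonempty := by
  have : Fact (R ∈ S) := ⟨hR⟩
  -- Putting the ones where `s + 1` divides `a + 1`, instead of `a`, forces `s ≤ a`; the search for
  -- the witness is thus bounded and the path belongs to `S`.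
  have hdec : Dec S fun p => ∃ s ≤ snd p, (pair s (fst p) ∈ R ∧ (∀ t < s, pair t (fst p) ∉ R)) ∧
    s + 1 ∣ snd p + 1 := by infer_instance
  have mem (n a s : M) (hs : pair s n ∈ R ∧ ∀ t < s, pair t n ∉ R) (h : s + 1 ∣ a + 1) :
      pair n a ∈ {p | ∃ s ≤ snd p, (pair s (fst p) ∈ R ∧ (∀ t < s, pair t (fst p) ∉ R)) ∧
        s + 1 ∣ snd p + 1} := by
    refine ⟨s, ?_, by simpa using hs, by simpa using h⟩
    rw [snd_pair]
    refine le_of_add_le_add_right (le_of_dvd' h ?_)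
    exact (add_pos_of_nonneg_of_pos zero_le zero_lt_one).ne'
  refine ⟨_, hdec.mem, fun σ hσ hi => ⟨hσ, fun n a d hd ha had => ?_, fun n a s hs hlt => ?_⟩⟩
  · obtain ⟨-, s, -, ⟨hs, least⟩, hdvd⟩ := hi.hasOne_iff.1 ha
    obtain ⟨-, s', -, ⟨hs', least'⟩, hdvd'⟩ := hi.hasOne_iff.1 had
    simp only [fst_pair, snd_pair] at hs least hdvd hs' least' hdvd'
    obtain rfl : s = s' := by
      rcases lt_trichotomy s s' with hlt | h | hlt
      · exact (least' s hlt hs).elim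
      · exact h
      · exact (least s' hlt hs').elim
    rw [add_right_comm] at hdvd'
    exact ⟨s, le_self_add.trans (le_of_dvd' (dvd_right_of_dvd_add hdvd' hdvd) hd), hs⟩
  · obtain ⟨t, ht, least⟩ := exists_least (S := S) (P := fun t => pair t n ∈ R) (by infer_instance)
      ⟨s, hs⟩
    have hts : t ≤ s := not_lt.1 fun hlt => least s hlt hs
    obtain ⟨b, hb, hdvd⟩ := exists_dvd_add S t a
    refine ⟨b, hb.trans hts, hi.hasOne_iff.2 ⟨lt_of_le_of_lt ?_ hlt, mem _ _ t ⟨ht, least⟩ hdvd⟩⟩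
    gcongr
    exact hb.trans hts

theorem isSystem_rowTree (hR : R ∈ S) : IsSystem S (rowTree R) (rowShift M) where
  tree_mem := rowTree_mem hR
  map_mem := rowShift_mem
  tree := isTree_rowTree
  map := encodesTransformation_rowShift S
  paths_nonempty := paths_rowTree_nonempty hR
  map_closed _ hσ _ h := rowTree_closed hσ h

theorem exists_pair_mem_of_mem_paths {X : Set M} (hX : X ∈ paths S (rowTree R)) {s n : M}
    (hs : pair s n ∈ R) : ∃ b, pair n b ∈ X := by
  obtain ⟨σ, hσ, hl, hi⟩ := exists_isInitSeg hX.1 (pair n (0 + s) + 1)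
  obtain ⟨b, -, hb⟩ := (hX.2 σ hσ hi).2.2 n 0 s hs (by rw [hl]; exact lt_add_one_iff.2 le_rfl)
  exact ⟨_, (hi.hasOne_iff.1 hb).2⟩

theorem exists_mem_of_two_ones {X : Set M} (hX : X ∈ paths S (rowTree R)) {n d : M} (hd : d ≠ 0)
    (h0 : pair n 0 ∈ X) (h1 : pair n d ∈ X) : ∃ s, pair s n ∈ R := by
  obtain ⟨σ, hσ, hl, hi⟩ := exists_isInitSeg hX.1 (pair n d + 1)
  obtain ⟨s, -, hs⟩ := (hX.2 σ hσ hi).2.1 n 0 d hd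
    (hi.hasOne_iff.2 ⟨by rw [hl]; exact lt_add_one_iff.2 (by gcongr; exact zero_le), h0⟩)
    (hi.hasOne_iff.2 ⟨by rw [hl, zero_add]; exact lt_add_one_iff.2 le_rfl, by rwa [zero_add]⟩)
  exact ⟨s, hs⟩

theorem IsMinimal.exists_iff {D : Set M} (hD : IsMinimal S D (rowShift M))
    (hsub : paths S D ⊆ paths S (rowTree R)) (n : M) :
    (∃ s, pair s n ∈ R) ↔ ∃ X ∈ paths S D, pair n 0 ∈ X := by
  constructor
  · rintro ⟨s, hs⟩
    obtain ⟨X, hX⟩ := hD.system.paths_nonempty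
    obtain ⟨b, hb⟩ := exists_pair_mem_of_mem_paths (hsub hX) hs
    exact ⟨_, hD.system.advance_mem_paths' hX b, by simpa using hb⟩
  · rintro ⟨X, hX, h0⟩
    by_contra hn
    have : Fact (D ∈ S) := ⟨hD.system.tree_mem⟩
    -- The subtree with row `n` empty; the bound on `j` loses nothing because `j ≤ pair n j`.
    have hdec : Dec S fun σ => σ ∈ D ∧ ∀ j < len σ, ¬ HasOne σ (pair n j) := by infer_instance
    have hE : IsSystem S {σ | σ ∈ D ∧ ∀ j < len σ, ¬ HasOne σ (pair n j)} (rowShift M) :=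
      { tree_mem := hdec.mem
        map_mem := rowShift_mem
        tree := ⟨fun σ hσ => hD.system.tree.isString σ hσ.1, fun τ hτ σ hσ h =>
          ⟨hD.system.tree.prefix_mem τ hτ.1 σ hσ h, fun j hj h1 =>
            hτ.2 j (hj.trans_le (isPrefix_iff.1 h).2.2.1)
              (((isPrefix_iff.1 h).2.2.2 _ h1.lt_len).1 h1)⟩⟩
        map := encodesTransformation_rowShift S
        paths_nonempty := by
          -- One shift discards the 1 at the start of row `n` of `X`. Any 1 left there would come
          -- from a second 1 of `X` in that row, giving `n` a witness.
          have hX' := hD.system.advance_mem_paths hX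
          refine ⟨_, hX'.1, fun σ hσ hi => ⟨hX'.2 σ hσ hi, fun j _ h1 => hn ?_⟩⟩
          have h2 := (hi.hasOne_iff.1 h1).2
          rw [Set.mem_ofPred_eq, advance_pair] at h2
          exact exists_mem_of_two_ones (hsub hX)
            (add_pos_of_nonneg_of_pos zero_le zero_lt_one).ne' h0 h2
        map_closed := fun σ hσ τ h => by
          refine ⟨hD.system.map_closed σ hσ.1 τ h, fun j hj h1 => ?_⟩
          have h2 := ((pair_mem_rowShift.1 h).2.2.2.2 _ h1.lt_len).1 h1
          rw [advance_pair] at h2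
          exact hσ.2 _ (((le_pair_right n _)).trans_lt h2.lt_len) h2 }
    have heq := hD.minimal _ hE (paths_mono fun σ hσ => hσ.1)
    rw [← heq] at hX
    obtain ⟨σ, hσ, hl, hi⟩ := exists_isInitSeg hX.1 (pair n 0 + 1)
    have hlt : pair n 0 < len σ := by rw [hl]; exact lt_add_one_iff.2 le_rfl
    exact (hX.2 σ hσ hi).2 0 (zero_le.trans_lt hlt) (hi.hasOne_iff.2 ⟨hlt, h0⟩)

/-- If every system contains a minimal subsystem then arithmetical comprehension holds. -/
theorem EverySystemContainsMinimal.aca (hW : WKL S) (h : EverySystemContainsMinimal S) : ACA S := by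
  refine .of_exists fun R hR => ?_
  have : Fact (R ∈ S) := ⟨hR⟩
  obtain ⟨D, hD, hsub⟩ := h _ _ (isSystem_rowTree hR)
  have : Fact (D ∈ S) := ⟨hD.system.tree_mem⟩
  -- The `Π⁰₁` form says that no level of `D` refutes a 1 at the start of row `x`; the number `y`
  -- determines a level and bounds the codes of its nodes.
  refine .delta (R := fun y x => pair y x ∈ R) (Q := fun y x => ¬ (IsBound y ∧ pair x 0 < len y ∧
    ∀ τ ≤ y, τ ∈ D → len τ = len y → ¬ HasOne τ (pair x 0))) (by infer_instance)
    (by infer_instance) fun n => ?_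
  rw [hD.exists_iff hsub]
  constructor
  · rintro ⟨X, hX, h0⟩ y ⟨hy, hlt, hall⟩
    obtain ⟨σ, hσ, hl, hi⟩ := exists_isInitSeg hX.1 (len y)
    exact hall σ (hy.le S hσ hl.le) (hX.2 σ hσ hi) hl (hi.hasOne_iff.2 ⟨hl ▸ hlt, h0⟩)
  · intro hy
    by_contra! hX
    obtain ⟨y, h⟩ := hW.exists_isBound_forall hD.system.tree_mem hD.system.tree hX
    exact hy y h

end RowShift

/-! ### ACA implies existence of minimal subsystems -/

section MinimalSubsystem

variable {M : Type*} [CommSemiring M] [LinearOrder M] [IsStrictOrderedRing M]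
  [CanonicallyOrderedAdd M] [Fact (BasicAxioms M)] {S : Set (Set M)} [hS : Fact (RCA0 S)]

/-- Definition of a set by course-of-values recursion. -/
theorem exists_recursive_set [Fact (ACA S)] (Φ : (M → Prop) → M → Prop)
    (hloc : ∀ A B k, (∀ i < k, A i ↔ B i) → (Φ A k ↔ Φ B k))
    (hΦ : Dec S fun w => Φ (HasOne (fst w)) (snd w)) :
    ∃ A ∈ S, ∀ k, k ∈ A ↔ Φ (fun i => i ∈ A) k := by
  let I (s k : M) : Prop := Φ (HasOne s) k
  have hI (F G : M → M) [Fn S F] [Fn S G] : Dec S fun x => I (F x) (G x) := .comp₂ (R := I) hΦ F G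
  have ex (l : M) : ∃ s, len s = l ∧ ∀ k < len s, HasOne s k ↔ I s k := by
    refine dec_induction (S := S) (P := fun l => ∃ s, len s = l ∧ ∀ k < len s, HasOne s k ↔ I s k)
      (by infer_instance) ?_ (fun l ⟨s, hl, hs⟩ => ?_) l
    · obtain ⟨s, -, hl, -⟩ := exists_string (S := S) (fun _ => True) (by infer_instance) 0
      exact ⟨s, hl, fun k hk => (not_lt_zero (hl ▸ hk)).elim⟩
    · obtain ⟨t, -, ht, h⟩ := exists_string (S := S) (fun k => I s k) (hI (fun _ => s) fun k => k)
        (l + 1)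
      refine ⟨t, ht, fun k hk => (h k (ht ▸ hk)).trans (hloc _ _ _ fun i hi => ?_)⟩
      have hil : i < l := hi.trans_le (lt_add_one_iff.1 (ht ▸ hk))
      rw [h i (hil.trans (lt_add_one_iff.2 le_rfl))]
      exact hs i (hl ▸ hil)
  -- Two finite approximations agree on their common domain: at a least disagreement, locality of
  -- `Φ` makes both take the same value.
  have uniq (s t : M) (hs : ∀ k < len s, HasOne s k ↔ I s k) (ht : ∀ k < len t, HasOne t k ↔ I t k)
      (k : M) (hks : k < len s) (hkt : k < len t) : HasOne s k ↔ HasOne t k := by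
    by_contra hn
    obtain ⟨j, ⟨hjs, hjt, hj⟩, least⟩ := exists_least (S := S)
      (P := fun k => k < len s ∧ k < len t ∧ ¬ (HasOne s k ↔ HasOne t k)) (by infer_instance)
      ⟨k, hks, hkt, hn⟩
    refine hj ((hs j hjs).trans ((hloc _ _ _ fun i hi => ?_).trans (ht j hjt).symm))
    by_contra hne
    exact least i hi ⟨hi.trans hjs, hi.trans hjt, hne⟩
  have hA : Dec S fun k => ∃ s, (∀ k < len s, HasOne s k ↔ I s k) ∧ HasOne s k := by infer_instance
  refine ⟨_, hA.mem, fun k => ?_⟩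
  have mem (s : M) (hs : ∀ k < len s, HasOne s k ↔ I s k) (k : M) (hk : k < len s) :
      HasOne s k ↔ k ∈ {k | ∃ s, (∀ k < len s, HasOne s k ↔ I s k) ∧ HasOne s k} :=
    ⟨fun h => ⟨s, hs, h⟩, fun ⟨t, ht, h⟩ => (uniq s t hs ht k hk h.lt_len).2 h⟩
  obtain ⟨s, hl, hs⟩ := ex (k + 1)
  have hk : k < len s := hl ▸ lt_add_one_iff.2 le_rfl
  rw [← mem s hs k hk, hs k hk]
  exact hloc _ _ _ fun i hi => mem s hs i (hi.trans hk)

/-- For the empty string, not covered by the normalization, monotonicity bounds its image by the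
image of a string of length 1, which is empty. -/
theorem EncodesTransformation.len_le {f : Set M} (hf : EncodesTransformation f) {σ τ : M}
    (h : pair σ τ ∈ f) (S : Set (Set M)) [Fact (RCA0 S)] : len τ ≤ len σ := by
  obtain ⟨σ', τ', hσ, hτ, e⟩ := hf.graph _ h
  obtain ⟨rfl, rfl⟩ := pair_inj.1 e
  rcases eq_or_ne (len σ) 0 with h0 | h0
  · obtain ⟨ρ, hρ, hl, -⟩ := exists_string (S := S) (fun _ => True) (by infer_instance) 1
    obtain ⟨ρ', hρ', -⟩ := hf.total ρ hρ
    have hp := hf.order_preserving _ _ _ _ h hρ' (isPrefix_iff.2 ⟨hσ.isCode, hρ.isCode, by simp [h0],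
      fun i hi => (not_lt_zero (h0 ▸ hi)).elim⟩)
    obtain ⟨-, hc, hle, -⟩ := isPrefix_iff.1 hp
    have := hf.length_lt _ _ hρ' _ _ hρ.hasLength (hasLength_iff.2 ⟨hc, rfl⟩) (by simp [hl])
    rw [hl, ← zero_add (1 : M), lt_add_one_iff] at this
    exact (hle.trans this).trans zero_le
  · exact (hf.length_lt _ _ h _ _ hσ.hasLength hτ.hasLength h0).le

/-- The finite set coded by the string `Z` is an initial part of a subsystem of `(C, f)` that
avoids `A`. -/
def IsPartialSubsystem (C f : Set M) (A : M → Prop) (Z : M) : Prop :=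
  (∀ τ, HasOne Z τ → τ ∈ C ∧ ¬ A τ) ∧
  (∀ τ, HasOne Z τ → ∀ σ, IsString σ → IsPrefix σ τ → HasOne Z σ) ∧
  ∀ τ, HasOne Z τ → ∀ ρ, pair τ ρ ∈ f → HasOne Z ρ

/-- There are arbitrarily long initial parts of subsystems of `(C, f)` that avoid `A`. -/
def Avoidable (C f : Set M) (A : M → Prop) : Prop :=
  ∀ l, ∃ Z, IsPartialSubsystem C f A Z ∧ ∃ σ, HasOne Z σ ∧ len σ = l

variable {C f : Set M}

/-- Truncating `T` at length `l` keeps it closed under `f`, since `f` does not lengthen strings, and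
makes it a finite set that a string can code. -/
theorem exists_isPartialSubsystem (hf : EncodesTransformation f) {T : Set M} (hT : T ∈ S)
    (tree : IsTree T) (hTC : T ⊆ C) (closed : ∀ σ ∈ T, ∀ τ, pair σ τ ∈ f → τ ∈ T) (A : M → Prop)
    (l : M) (hA : ∀ σ ∈ T, len σ ≤ l → ¬ A σ) :
    ∃ Z, IsPartialSubsystem C f A Z ∧ ∀ σ, HasOne Z σ ↔ σ ∈ T ∧ len σ ≤ l := by
  have : Fact (T ∈ S) := ⟨hT⟩
  obtain ⟨y, hy, hl⟩ := exists_isBound S l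
  obtain ⟨Z, -, hZl, hZ⟩ := exists_string (S := S) (fun σ => σ ∈ T ∧ len σ ≤ l) (by infer_instance)
    (y + 1)
  have mem (σ : M) : HasOne Z σ ↔ σ ∈ T ∧ len σ ≤ l := by
    refine ⟨fun h => (hZ σ (hZl ▸ h.lt_len)).1 h, fun h => (hZ σ (lt_add_one_iff.2 ?_)).2 h⟩
    exact hy.le S (tree.isString σ h.1) (hl ▸ h.2)
  refine ⟨Z, ⟨fun τ h => ?_, fun τ h σ hσ hp => ?_, fun τ h ρ hρ => ?_⟩, mem⟩
  · exact ⟨hTC ((mem τ).1 h).1, hA τ ((mem τ).1 h).1 ((mem τ).1 h).2⟩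
  · exact (mem σ).2 ⟨tree.prefix_mem τ ((mem τ).1 h).1 σ hσ hp,
      (isPrefix_iff.1 hp).2.2.1.trans ((mem τ).1 h).2⟩
  · exact (mem ρ).2 ⟨closed τ ((mem τ).1 h).1 ρ hρ, (hf.len_le hρ S).trans ((mem τ).1 h).2⟩

theorem Avoidable.congr {A B : M → Prop} (h : Avoidable C f A) (hAB : ∀ τ, A τ ↔ B τ) :
    Avoidable C f B := by
  obtain rfl : A = B := funext fun τ => propext (hAB τ)
  exact h

/-- The truncations of `T ∩ E` are the required finite sets; a path of `E` supplies a string of each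
length in them. -/
theorem IsSystem.avoidable_of_avoid {E T : Set M} (hC : IsSystem S C f) (hE : IsSystem S E f)
    (hT : T ∈ S) (tree : IsTree T) (hTC : T ⊆ C) (closed : ∀ σ ∈ T, ∀ τ, pair σ τ ∈ f → τ ∈ T)
    (hET : paths S E ⊆ paths S T) {A : M → Prop} (hA : ∀ σ ∈ T, σ ∈ E → ¬ A σ) :
    Avoidable C f A := fun l => by
  have : Fact (T ∈ S) := ⟨hT⟩
  have : Fact (E ∈ S) := ⟨hE.tree_mem⟩
  have hdec : Dec S fun σ => σ ∈ T ∧ σ ∈ E := by infer_instance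
  obtain ⟨Z, hZ, mem⟩ := exists_isPartialSubsystem hC.map hdec.mem
    ⟨fun σ h => tree.isString σ h.1, fun τ hτ σ hσ hp => ⟨tree.prefix_mem τ hτ.1 σ hσ hp,
      hE.tree.prefix_mem τ hτ.2 σ hσ hp⟩⟩ (fun σ h => hTC h.1)
    (fun σ hσ τ h => ⟨closed σ hσ.1 τ h, hE.map_closed σ hσ.2 τ h⟩) A l
    fun σ hσ _ => hA σ hσ.1 hσ.2
  obtain ⟨Y, hY⟩ := hE.paths_nonempty
  obtain ⟨σ, hσ, hl, hi⟩ := exists_isInitSeg hY.1 l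
  exact ⟨Z, hZ, σ, (mem σ).2 ⟨⟨(hET hY).2 σ hσ hi, hY.2 σ hσ hi⟩, hl.le⟩, hl⟩

/-- Arithmetical comprehension implies that every system contains a minimal subsystem. -/
theorem ACA.everySystemContainsMinimal (hACA : ACA S) (hW : WKL S) :
    EverySystemContainsMinimal S := by
  intro C f hC
  have : Fact (ACA S) := ⟨hACA⟩
  have : Fact (C ∈ S) := ⟨hC.tree_mem⟩
  have : Fact (f ∈ S) := ⟨hC.map_mem⟩
  obtain ⟨A, hA, greedy⟩ := exists_recursive_set (S := S)
    (fun A k => Avoidable C f fun τ => (τ < k ∧ A τ) ∨ τ = k)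
    (fun A B k h => by
      have e (τ : M) : (τ < k ∧ A τ) ∨ τ = k ↔ (τ < k ∧ B τ) ∨ τ = k :=
        or_congr_left (and_congr_right fun hτ => h τ hτ)
      exact ⟨fun hA => hA.congr e, fun hB => hB.congr fun τ => (e τ).symm⟩)
    (by
      simp only [Avoidable, IsPartialSubsystem]
      infer_instance)
  have : Fact (A ∈ S) := ⟨hA⟩
  have avoid (k : M) : Avoidable C f fun τ => τ < k ∧ τ ∈ A := by
    refine dec_induction (S := S) (P := fun k => Avoidable C f fun τ => τ < k ∧ τ ∈ A)
      (by simp only [Avoidable, IsPartialSubsystem]; infer_instance) ?_ (fun k ih => ?_) k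
    · exact hC.avoidable_of_avoid hC hC.tree_mem hC.tree subset_rfl hC.map_closed subset_rfl
        fun σ _ _ h => not_lt_zero h.1
    · by_cases hk : k ∈ A
      · refine ((greedy k).1 hk).congr fun τ => ?_
        rw [lt_add_one_iff, le_iff_lt_or_eq, or_and_right]
        exact or_congr_right ⟨fun e => ⟨e, e ▸ hk⟩, fun e => e.1⟩
      · refine ih.congr fun τ => and_congr_left fun hτ => ?_
        rw [lt_add_one_iff]
        exact (lt_iff_le_and_ne.trans (and_iff_left fun e => hk (e ▸ hτ)))
  have hdec : Dec S fun τ => ∃ Z, IsPartialSubsystem C f (fun τ => τ ∈ A) Z ∧ HasOne Z τ := by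
    simp only [IsPartialSubsystem]
    infer_instance
  set D : Set M := {τ | ∃ Z, IsPartialSubsystem C f (fun τ => τ ∈ A) Z ∧ HasOne Z τ}
  have hDC : D ⊆ C := fun τ ⟨Z, hZ, h⟩ => (hZ.1 τ h).1
  have hDA (τ : M) : τ ∈ D → τ ∉ A := fun ⟨Z, hZ, h⟩ => (hZ.1 τ h).2
  have tree : IsTree D := ⟨fun σ h => hC.tree.isString σ (hDC h),
    fun τ ⟨Z, hZ, h⟩ σ hσ hp => ⟨Z, hZ, hZ.2.1 τ h σ hσ hp⟩⟩
  have closed : ∀ σ ∈ D, ∀ τ, pair σ τ ∈ f → τ ∈ D := fun σ ⟨Z, hZ, h⟩ τ hτ =>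
    ⟨Z, hZ, hZ.2.2 σ h τ hτ⟩
  have hDsys : IsSystem S D f :=
    { tree_mem := hdec.mem
      map_mem := hC.map_mem
      tree := tree
      map := hC.map
      paths_nonempty := hW.nonempty_paths hdec.mem tree fun l => by
        obtain ⟨y, hy, hl⟩ := exists_isBound S l
        -- Avoiding `A` up to `y` is enough: after truncation of `Z` to length `l`, all remaining
        -- strings have codes at most `y`, so all of `A` is avoided.
        obtain ⟨Z, hZ, σ, hσ, rfl⟩ := avoid (y + 1) l
        have hdecZ : Dec S (HasOne Z) := inferInstance
        obtain ⟨Z', hZ', mem⟩ := exists_isPartialSubsystem (C := C) hC.map hdecZ.mem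
          ⟨fun τ h => hC.tree.isString τ (hZ.1 τ h).1, hZ.2.1⟩ (fun τ h => (hZ.1 τ h).1) hZ.2.2
          (fun τ => τ ∈ A) (len σ) fun τ hτ hle hτA => (hZ.1 τ hτ).2 ⟨lt_add_one_iff.2
            (hy.le S (hC.tree.isString τ (hZ.1 τ hτ).1) (hl ▸ hle)), hτA⟩
        exact ⟨σ, ⟨Z', hZ', (mem σ).2 ⟨hσ, le_rfl⟩⟩, le_rfl⟩
      map_closed := closed }
  refine ⟨D, ⟨hDsys, fun E hE hED => hED.antisymm fun X hX => ?_⟩, paths_mono hDC⟩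
  by_contra hXE
  obtain ⟨σ, hσ, hi, hσE⟩ : ∃ σ, IsString σ ∧ IsInitSeg σ X ∧ σ ∉ E := by
    by_contra! hn
    exact hXE ⟨hX.1, hn⟩
  -- Strings of `D` are not in `A`, yet `D ∩ E` witnesses that `σ` can be avoided along with `A`, so
  -- the greedy choice put `σ` into `A`.
  refine hDA σ (hX.2 σ hσ hi) ((greedy σ).2 ?_)
  refine hC.avoidable_of_avoid hE hdec.mem tree hDC closed hED fun τ hτD hτE => ?_
  rintro (⟨-, hτA⟩ | rfl)
  · exact hDA τ hτD hτA
  · exact hσE hτE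

end MinimalSubsystem

end SOA

theorem mainTheorem3 {M : Type*} [Zero M] [One M] [Add M] [Mul M] [LT M]
    (S : Set (Set M)) (hS : SOA.WKL0 S) :
    SOA.ACA S ↔ SOA.EverySystemContainsMinimal S := by
  -- These instances are built on the given operations and the given `<`, so the definitions made
  -- for a bare structure keep their meaning.
  let _ := hS.rca0.commSemiring
  let _ := hS.rca0.linearOrder
  have := hS.rca0.isStrictOrderedRing
  have := hS.rca0.canonicallyOrderedAdd
  have : Fact (SOA.BasicAxioms M) := ⟨hS.rca0.basic⟩
  have : Fact (SOA.RCA0 S) := ⟨hS.rca0⟩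
  exact ⟨fun h => SOA.ACA.everySystemContainsMinimal h hS.wkl,
    fun h => SOA.EverySystemContainsMinimal.aca hS.wkl h⟩
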